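/- Let $\mathbb H^2$ be the hyperbolic plane. For a lattice $\Gamma$ in $\mathrm{PSL}_2(\mathbb R)$ (a discrete subgroup such that $\Gamma\backslash\mathbb H^2$ has finite area) let $O=\Gamma\backslash\mathbb H^2$ be the corresponding orientable hyperbolic $2$-orbifold, with its hyperbolic area $\operatorname{vol}$ and its quotient metric. For $R>0$ the thin parts of $O$ are $$O_{<R}=\Gamma\backslash\{z\in\mathbb H^2:\ \exists\,\gamma\in\Gamma\setminus\{\mathrm{Id}\},\ d(z,\gamma z)<R\},\qquad O_{\le R}=\Gamma\backslash\{z\in\mathbb H^2:\ \exists\,\gamma\in\Gamma\setminus\{\mathrm{Id}\},\ d(z,\gamma z)\le R\}.$$ The cone points of $O$ are the images of the points of $\mathbb H^2$ fixed by a nontrivial element of $\Gamma$; the cusps of $O$ are the $\Gamma$-orbits of points of $\mathbb R\cup\{\infty\}$ fixed by a parabolic element of $\Gamma$. A sequence $O_n=\Gamma_n\backslash\mathbb H^2$ of such orbifolds Benjamini--Schramm converges to $\mathbb H^2$ if $\operatorname{vol}((O_n)_{<R})/\operatorname{vol}(O_n)\to 0$ for every $R>0$. **Proposition.** (a) Let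 $O_n=\Gamma_n\backslash\mathbb H^2$ be a sequence of such orbifolds that Benjamini--Schramm converges to $\mathbb H^2$, and let $k_n$ and $r_n$ be the numbers of cusps and of cone points of $O_n$. Then $k_n$ and $r_n$ are finite and $k_n+r_n=o(\operatorname{vol} O_n)$ as $n\to\infty$. (b) There is $\varepsilon_0>0$ such that for every $0<\varepsilon\le\varepsilon_0$ there is $c>0$ with the following property. For every lattice $\Gamma$ in $\mathrm{PSL}_2(\mathbb R)$, with $O=\Gamma\backslash\mathbb H^2$, one can choose for each cone point $x$ an open metric ball $\Omega_x\subset O$ of positive radius centred at $x$, and for each cusp $\kappa$ a region $\Omega_\kappa\subset O$ that is the image of an open horoball based at a point of the orbit $\kappa$, such that all these regions are contained in $O_{\le\varepsilon}$ and have area at least $c$, regions of distinct cusps are disjoint, and every point of $O$ lies in at most two of the regions. -/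

import Mathlib

open MeasureTheory Filter Asymptotics
open scoped MatrixGroups UpperHalfPlane ENNReal Topology

namespace HypOrbifold

/-- The orbifold `Γ \ ℍ²`, for a subgroup `Γ` of `SL(2, ℝ)` acting on the hyperbolic plane
(the upper half-plane with Mathlib's metric and area `dx dy / y ^ 2`) by Möbius transformations.
It depends only on the image of `Γ` in `PSL(2, ℝ) = SL(2, ℝ) / {±1}`, and every subgroup of
`PSL(2, ℝ)` is the image of some `Γ`. -/
abbrev Orbifold (Γ : Subgroup SL(2, ℝ)) : Type := MulAction.orbitRel.Quotient Γ ℍ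

/-- The projection `ℍ² → Γ \ ℍ²`. -/
noncomputable def proj (Γ : Subgroup SL(2, ℝ)) (z : ℍ) : Orbifold Γ := Quotient.mk _ z

/-- The hyperbolic area of a set `A` in `Γ \ ℍ²`: the area of a measurable set of
representatives in `ℍ²`, one for each point of `A`. It is written as the supremum of the areas of
the measurable sets of representatives of subsets of `A`, so that no fundamental domain
has to be chosen. -/
noncomputable def vol (Γ : Subgroup SL(2, ℝ)) (A : Set (Orbifold Γ)) : ℝ≥0∞ :=
  ⨆ (S : Set ℍ) (_ : MeasurableSet S) (_ : S ⊆ proj Γ ⁻¹' A) (_ : Set.InjOn (proj Γ) S),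
    (volume : Measure ℍ) S

/-- `Γ` is a lattice: it is discrete, and `Γ \ ℍ²` has finite area. -/
structure IsLattice (Γ : Subgroup SL(2, ℝ)) : Prop where
  discrete : DiscreteTopology Γ
  finite_vol : vol Γ Set.univ < ∞

/-- The closed thin part `O_{≤ ε}`: the image of the points moved by at most `ε` by an element
of `Γ` that is nontrivial in `PSL(2, ℝ)`. It contains the singular points. -/
def thinLE (Γ : Subgroup SL(2, ℝ)) (ε : ℝ) : Set (Orbifold Γ) :=
  proj Γ '' {z : ℍ | ∃ γ ∈ Γ, γ ≠ 1 ∧ γ ≠ -1 ∧ dist z (γ • z) ≤ ε}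

/-- The open thin part `O_{< R}`. -/
def thinLT (Γ : Subgroup SL(2, ℝ)) (R : ℝ) : Set (Orbifold Γ) :=
  proj Γ '' {z : ℍ | ∃ γ ∈ Γ, γ ≠ 1 ∧ γ ≠ -1 ∧ dist z (γ • z) < R}

/-- Benjamini–Schramm convergence of `Γ n \ ℍ²` to `ℍ²`: for every `R > 0`, the proportion of
the area taken by the `R`-thin part tends to `0`. -/
def BSConvergesToPlane (Γ : ℕ → Subgroup SL(2, ℝ)) : Prop :=
  ∀ R : ℝ, 0 < R →
    Tendsto (fun n => vol (Γ n) (thinLT (Γ n) R) / vol (Γ n) Set.univ) atTop (𝓝 0)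

/-- The cone points of `Γ \ ℍ²`: the images of the points fixed by an element of `Γ` that is
nontrivial in `PSL(2, ℝ)`. -/
def conePoints (Γ : Subgroup SL(2, ℝ)) : Set (Orbifold Γ) :=
  proj Γ '' {z : ℍ | ∃ γ ∈ Γ, γ ≠ 1 ∧ γ ≠ -1 ∧ γ • z = z}

/-- The image of `Γ` under the inclusion `SL(2, ℝ) → GL(2, ℝ)`. -/
noncomputable abbrev toGL (Γ : Subgroup SL(2, ℝ)) : Subgroup (GL (Fin 2) ℝ) :=
  Γ.map (Matrix.SpecialLinearGroup.mapGL ℝ)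

/-- The cusps of `Γ \ ℍ²`: the `Γ`-orbits of points of `ℝ ∪ {∞}` fixed by a parabolic element
of `Γ`. -/
abbrev Cusps (Γ : Subgroup SL(2, ℝ)) : Type := CuspOrbits (toGL Γ)

/-- The open ball of radius `r` around `x`, for the quotient metric on `Γ \ ℍ²`. -/
def ball (Γ : Subgroup SL(2, ℝ)) (x : Orbifold Γ) (r : ℝ) : Set (Orbifold Γ) :=
  {y | ∃ z w : ℍ, proj Γ z = x ∧ proj Γ w = y ∧ dist z w < r}

/-- `H` is an open horoball of `ℍ²` based at the boundary point `c ∈ ℝ ∪ {∞}`: an isometric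
image of `{im z > 1}`. -/
def IsHoroballAt (c : OnePoint ℝ) (H : Set ℍ) : Prop :=
  ∃ g : SL(2, ℝ), Matrix.SpecialLinearGroup.mapGL ℝ g • (OnePoint.infty : OnePoint ℝ) = c ∧
    H = (fun z : ℍ => g • z) '' {z : ℍ | 1 < z.im}

/-- `A` is a neighbourhood of the cusp `c` of `Γ \ ℍ²`: the image of a horoball based at a point
of the orbit `c`. -/
def IsCuspNhd (Γ : Subgroup SL(2, ℝ)) (c : Cusps Γ) (A : Set (Orbifold Γ)) : Prop :=
  ∃ (p : cuspsSubMulAction (toGL Γ)) (H : Set ℍ),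
    (Quotient.mk _ p : Cusps Γ) = c ∧ IsHoroballAt (p : OnePoint ℝ) H ∧ A = proj Γ '' H

/-- A choice of regions `Ω`, one for each cone point and each cusp of `Γ \ ℍ²`, such that the
region of a cone point is a ball around it, the region of a cusp is a horoball neighbourhood of
it, all regions lie in the `ε`-thin part and have area at least `c`, regions of distinct cusps are
disjoint, and no point lies in more than two regions. -/
structure IsThinRegions (Γ : Subgroup SL(2, ℝ)) (ε c : ℝ)
    (Ω : conePoints Γ ⊕ Cusps Γ → Set (Orbifold Γ)) : Prop where
  cone : ∀ x : conePoints Γ, ∃ r : ℝ, 0 < r ∧ Ω (Sum.inl x) = ball Γ x r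
  cusp : ∀ k : Cusps Γ, IsCuspNhd Γ k (Ω (Sum.inr k))
  thin : ∀ s, Ω s ⊆ thinLE Γ ε
  vol_ge : ∀ s, ENNReal.ofReal c ≤ vol Γ (Ω s)
  disjoint : ∀ k k' : Cusps Γ, k ≠ k' → Disjoint (Ω (Sum.inr k)) (Ω (Sum.inr k'))
  overlap : ∀ y : Orbifold Γ, {s | y ∈ Ω s}.encard ≤ 2

end HypOrbifold

/-! Everything rests on a Margulis lemma with an explicit constant, `margulis`: in a discrete group,
if two elements move a point `z` by at most 1/60 and the first is nontrivial and not a half-turn,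
then they commute, unless the second is a half-turn inverting the first, which is then hyperbolic.
Close to the identity matrix this is the Zassenhaus argument: iterated commutators contract, hence
become trivial by discreteness (`commute_of_devAt`). A rotation of large angle can move `z` little
without being close to the identity; it is replaced by a commutator with it, whose trace is at least
2 and which is therefore close to the identity when its displacement is small.

Each region is taken as large as the thin part allows. At a cusp it is the horoball on whose
boundary the shortest parabolic translation has length exactly ε. At a cone point of order greater
than 2 it is the ball on whose boundary the smallest rotation moves points by exactly ε. At a cone
point of order 2 it is the ball of radius ε/2, or a larger one if the half-turn inverts a short
hyperbolic element: the axis then passes through the point, and the ball extends until that element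
moves the points farthest from the axis by ε. In each case Margulis shows that some boundary point
`w` is moved by at least ε by the whole group. Hence a disc of radius ε/4 inside the region and
centred within ε/4 of `w` embeds in the quotient, which gives the area bound (`volume_ball_le_vol`).

A point in several regions has one small displacement for each of them, and Margulis applies to
these. A parabolic element, or a rotation of order greater than 2, then excludes every other region
(`cusp_eq_of_overlap`, `not_cusp_cone_overlap`, `eq_of_elliptic_overlap`). Only half-turns remain,
all inverting one hyperbolic element, so that their centres lie on its axis. The diagonal group
translates this axis by a cyclic group, and parity leaves at most two orbits of centres
(`exists_smul_eq_of_three_halfTurns`). Overlaps are therefore at most double.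

For (a), at most double overlap and the area bound make the number of regions at most a constant
times the area of the thin part (`IsThinRegions.card_le`). This is finite for a lattice and is
`o(vol)` under Benjamini–Schramm convergence. -/

namespace HypOrbifold

/-! ### Algebra of `SL(2, ℝ)`: traces, commutants, commutators. -/

section Algebra

lemma sl_det (g : SL(2, ℝ)) : g 0 0 * g 1 1 - g 0 1 * g 1 0 = 1 := by
  have := g.det_coe
  rwa [Matrix.det_fin_two] at this

lemma sl_mul_apply (g h : SL(2, ℝ)) (i j : Fin 2) :
    (g * h) i j = g i 0 * h 0 j + g i 1 * h 1 j := by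
  rw [Matrix.SpecialLinearGroup.coe_mul, Matrix.mul_apply, Fin.sum_univ_two]

lemma sl_inv_00 (g : SL(2, ℝ)) : g⁻¹ 0 0 = g 1 1 := by
  rw [Matrix.SpecialLinearGroup.SL2_inv_expl]; rfl
lemma sl_inv_01 (g : SL(2, ℝ)) : g⁻¹ 0 1 = -g 0 1 := by
  rw [Matrix.SpecialLinearGroup.SL2_inv_expl]; rfl
lemma sl_inv_10 (g : SL(2, ℝ)) : g⁻¹ 1 0 = -g 1 0 := by
  rw [Matrix.SpecialLinearGroup.SL2_inv_expl]; rfl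
lemma sl_inv_11 (g : SL(2, ℝ)) : g⁻¹ 1 1 = g 0 0 := by
  rw [Matrix.SpecialLinearGroup.SL2_inv_expl]; rfl

lemma sl_ext_iff {g h : SL(2, ℝ)} :
    g = h ↔ g 0 0 = h 0 0 ∧ g 0 1 = h 0 1 ∧ g 1 0 = h 1 0 ∧ g 1 1 = h 1 1 := by
  rw [Matrix.SpecialLinearGroup.ext_iff]
  simp only [Fin.forall_fin_two]
  tauto

lemma sl_neg_apply (g : SL(2, ℝ)) (i j : Fin 2) : (-g) i j = -g i j := by
  simp [Matrix.SpecialLinearGroup.coe_neg]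

lemma sl_one_00 : (1 : SL(2, ℝ)) 0 0 = 1 := by simp
lemma sl_one_11 : (1 : SL(2, ℝ)) 1 1 = 1 := by simp

/-- The trace of an element of `SL(2, ℝ)`. -/
noncomputable def tr (g : SL(2, ℝ)) : ℝ := g 0 0 + g 1 1

lemma tr_neg (g : SL(2, ℝ)) : tr (-g) = -tr g := by
  simp only [tr, sl_neg_apply]; ring

lemma tr_mul_comm (g h : SL(2, ℝ)) : tr (g * h) = tr (h * g) := by
  simp only [tr, sl_mul_apply]; ring

lemma tr_conj (g h : SL(2, ℝ)) : tr (g * h * g⁻¹) = tr h := by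
  rw [tr_mul_comm, inv_mul_cancel_left]

lemma tr_one : tr 1 = 2 := by simp only [tr, sl_one_00, sl_one_11]; norm_num

/-- `g` is nontrivial in `PSL(2, ℝ)`. -/
def NonTriv (g : SL(2, ℝ)) : Prop := g ≠ 1 ∧ g ≠ -1

lemma nonTriv_of_tr {g : SL(2, ℝ)} (h : tr g ^ 2 ≠ 4) : NonTriv g := by
  constructor
  · rintro rfl; apply h; rw [tr_one]; norm_num
  · rintro rfl; apply h; rw [tr_neg, tr_one]; norm_num

lemma NonTriv.conj {g : SL(2, ℝ)} (h : NonTriv g) (u : SL(2, ℝ)) : NonTriv (u * g * u⁻¹) := by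
  refine ⟨fun h1 => h.1 ?_, fun h1 => h.2 ?_⟩
  · rwa [conj_eq_one_iff] at h1
  · have : g = u⁻¹ * (u * g * u⁻¹) * u := by group
    rw [this, h1]; simp

lemma NonTriv.neg {g : SL(2, ℝ)} (h : NonTriv g) : NonTriv (-g) :=
  ⟨fun h1 => h.2 (by rw [← h1, neg_neg]), fun h1 => h.1 (neg_injective h1)⟩

lemma nonTriv_iff {g : SL(2, ℝ)} : NonTriv g ↔ ¬ (g 0 1 = 0 ∧ g 1 0 = 0 ∧ g 0 0 = g 1 1) := by
  constructor
  · rintro ⟨h1, h2⟩ ⟨h3, h4, h5⟩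
    have hd := sl_det g
    rw [h3, h5] at hd
    have : (g 1 1 - 1) * (g 1 1 + 1) = 0 := by linarith
    rcases mul_eq_zero.mp this with h | h
    · apply h1; rw [sl_ext_iff]; simp; exact ⟨by linarith, h3, h4, by linarith⟩
    · apply h2; rw [sl_ext_iff]; simp; exact ⟨by linarith, h3, h4, by linarith⟩
  · intro h
    constructor <;> rintro rfl <;> apply h <;> simp

/-- The commutant of a nonscalar `2 × 2` matrix consists of polynomials in it. -/
lemma exists_eq_of_commute {A X : SL(2, ℝ)} (hA : NonTriv A) (h : A * X = X * A) :
    ∃ s t : ℝ, X 0 0 = s + t * A 0 0 ∧ X 0 1 = t * A 0 1 ∧ X 1 0 = t * A 1 0 ∧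
      X 1 1 = s + t * A 1 1 := by
  rw [sl_ext_iff] at h
  simp only [sl_mul_apply] at h
  obtain ⟨h1, h2, h3, h4⟩ := h
  by_cases hb : A 0 1 = 0
  · by_cases hc : A 1 0 = 0
    · have had : A 0 0 - A 1 1 ≠ 0 := fun h => nonTriv_iff.mp hA ⟨hb, hc, by linarith⟩
      simp only [hb, hc] at h1 h2 h3 h4 ⊢
      refine ⟨X 0 0 - (X 0 0 - X 1 1) / (A 0 0 - A 1 1) * A 0 0,
        (X 0 0 - X 1 1) / (A 0 0 - A 1 1), by ring, ?_, ?_, ?_⟩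
      · have : (A 0 0 - A 1 1) * X 0 1 = 0 := by linarith
        simpa [had] using this
      · have : (A 0 0 - A 1 1) * X 1 0 = 0 := by linarith
        simpa [had] using this
      · field_simp; ring
    · refine ⟨X 0 0 - X 1 0 / A 1 0 * A 0 0, X 1 0 / A 1 0, by ring, ?_, by field_simp, ?_⟩
      · field_simp; linarith
      · field_simp; linarith
  · refine ⟨X 0 0 - X 0 1 / A 0 1 * A 0 0, X 0 1 / A 0 1, by ring, by field_simp, ?_, ?_⟩
    · field_simp; linarith
    · field_simp; linarith

/-- Since `X = s + t A`, the discriminant scales by `t ^ 2`. Commuting nontrivial elements thus have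
the same type: elliptic, parabolic or hyperbolic. -/
lemma exists_discr_eq_of_commute {A X : SL(2, ℝ)} (hA : NonTriv A) (hX : NonTriv X)
    (h : A * X = X * A) : ∃ t : ℝ, t ≠ 0 ∧ tr X ^ 2 - 4 = t ^ 2 * (tr A ^ 2 - 4) := by
  obtain ⟨s, t, h1, h2, h3, h4⟩ := exists_eq_of_commute hA h
  refine ⟨t, ?_, ?_⟩
  · rintro rfl
    exact nonTriv_iff.mp hX ⟨by simpa using h2, by simpa using h3, by linarith⟩
  · have e1 := sl_det A
    have e2 := sl_det X
    have : ∀ g : SL(2, ℝ), tr g ^ 2 - 4 = (g 0 0 - g 1 1) ^ 2 + 4 * (g 0 1 * g 1 0) := by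
      intro g
      have := sl_det g
      unfold tr
      linear_combination 4 * this
    rw [this, this, h1, h2, h3, h4]; ring

/-- The commutator with an elliptic element has trace at least `2`. -/
lemma two_le_tr_commutator {P g : SL(2, ℝ)} (hP : tr P ^ 2 < 4) : 2 ≤ tr (P * (g * P⁻¹ * g⁻¹)) := by
  have hd := sl_det P
  have hg := sl_det g
  set a := P 0 0 with ha
  set b := P 0 1 with hb
  set c := P 1 0 with hc
  set d := P 1 1 with hd'
  set p := g 0 0
  set q := g 0 1
  set r := g 1 0
  set s := g 1 1
  have hbc : (a - d) ^ 2 + 4 * (b * c) < 0 := by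
    have : tr P = a + d := rfl
    rw [this] at hP; nlinarith
  set k := b * r - q * c with hk
  set l := a * q + b * s - p * b - q * d with hl
  set m := c * p + d * r - r * a - s * c with hm
  -- `k`, `l`, `m` are the entries of the traceless matrix `P g - g P`, whose determinant is 2 minus
  -- the trace of the commutator.
  have key : tr (P * (g * P⁻¹ * g⁻¹)) - 2 = k ^ 2 + l * m := by
    simp only [tr, sl_mul_apply, sl_inv_00, sl_inv_01, sl_inv_10, sl_inv_11]
    simp only [← ha, ← hb, ← hc, ← hd']
    change a * ((p * d + q * -c) * s + (p * -b + q * a) * -r)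
      + b * ((r * d + s * -c) * s + (r * -b + s * a) * -r) +
      (c * ((p * d + q * -c) * -q + (p * -b + q * a) * p) +
        d * ((r * d + s * -c) * -q + (r * -b + s * a) * p)) - 2 = _
    rw [hk, hl, hm]
    linear_combination (2 * (p * s - q * r)) * hd + 2 * hg
  -- `P g - g P` is orthogonal to `P` for the trace form. On traceless matrices `k ^ 2 + l * m` has
  -- signature (2, 1), and it is negative on the traceless part of an elliptic `P`, hence
  -- nonnegative on the orthogonal complement.
  have hlin : (a - d) * k + b * m + c * l = 0 := by rw [hk, hl, hm]; ring
  have h4 : 4 * (b * c) * (k ^ 2 + l * m)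
      = ((a - d) ^ 2 + 4 * (b * c)) * k ^ 2 - (b * m - c * l) ^ 2 := by
    have : (a - d) ^ 2 * k ^ 2 = (b * m + c * l) ^ 2 := by
      have : (a - d) * k = -(b * m + c * l) := by linarith
      rw [← mul_pow, this]; ring
    linear_combination -this
  have hbc' : b * c < 0 := by nlinarith [sq_nonneg (a - d)]
  have : 4 * (b * c) * (k ^ 2 + l * m) ≤ 0 := by
    rw [h4]; nlinarith [sq_nonneg k, sq_nonneg (b * m - c * l)]
  have : 0 ≤ k ^ 2 + l * m := by
    by_contra hn
    push Not at hn
    nlinarith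
  linarith

end Algebra

/-! ### Displacement formulas and fixed points. -/

section Geometry

lemma sl_coe_smul (g : SL(2, ℝ)) (z : ℍ) :
    ((g • z : ℍ) : ℂ) = ((g 0 0 : ℂ) * z + g 0 1) / ((g 1 0 : ℂ) * z + g 1 1) := by
  rw [UpperHalfPlane.coe_specialLinearGroup_apply]; rfl

lemma sl_denom_ne_zero (g : SL(2, ℝ)) (z : ℍ) : ((g 1 0 : ℂ) * z + g 1 1) ≠ 0 := by
  have := UpperHalfPlane.denom_ne_zero (Matrix.SpecialLinearGroup.mapGL ℝ g) z
  simpa [UpperHalfPlane.denom] using this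

lemma sl_neg_smul (g : SL(2, ℝ)) (z : ℍ) : (-g) • z = g • z := by
  apply UpperHalfPlane.ext
  rw [sl_coe_smul, sl_coe_smul]
  simp only [sl_neg_apply, Complex.ofReal_neg]
  rw [neg_mul, neg_mul, ← neg_add, ← neg_add, neg_div_neg_eq]

lemma sl_im_smul (g : SL(2, ℝ)) (z : ℍ) :
    (g • z).im = z.im / Complex.normSq ((g 1 0 : ℂ) * z + g 1 1) := by
  have h := sl_denom_ne_zero g z
  have hN : Complex.normSq ((g 1 0 : ℂ) * z + g 1 1) ≠ 0 := by simpa using h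
  have hd := sl_det g
  rw [← UpperHalfPlane.coe_im, sl_coe_smul, Complex.div_im, ← sub_div]
  congr 1
  simp
  linear_combination z.im * hd

/-- With entries `a, b, c, d`, one has `z - g z = (c z² + (d - a) z - b) / (c z + d)`, and the
denominator cancels against that of `im (g z)`. The displacement formulas for rotations, diagonal
and unipotent elements are special cases. -/
lemma sinh_half_dist_smul_sq (g : SL(2, ℝ)) (z : ℍ) :
    Real.sinh (dist z (g • z) / 2) ^ 2 =
      ((g 1 0 * (z.re ^ 2 - z.im ^ 2) + (g 1 1 - g 0 0) * z.re - g 0 1) ^ 2 +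
        (2 * g 1 0 * z.re * z.im + (g 1 1 - g 0 0) * z.im) ^ 2) / (4 * z.im ^ 2) := by
  have h := sl_denom_ne_zero g z
  have hN : Complex.normSq ((g 1 0 : ℂ) * z + g 1 1) ≠ 0 := by simpa using h
  have hy := z.im_ne_zero
  rw [UpperHalfPlane.sinh_half_dist, div_pow, mul_pow, Real.sq_sqrt (by positivity), sl_im_smul,
    Complex.dist_eq, Complex.sq_norm, sl_coe_smul]
  have : (z : ℂ) - ((g 0 0 : ℂ) * z + g 0 1) / ((g 1 0 : ℂ) * z + g 1 1) =
      ((g 1 0 : ℂ) * z ^ 2 + (g 1 1 - g 0 0) * z - g 0 1) / ((g 1 0 : ℂ) * z + g 1 1) := by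
    rw [eq_div_iff h, sub_mul, div_mul_cancel₀ _ h]
    ring
  rw [this, Complex.normSq_div]
  have h2 : Complex.normSq ((g 1 0 : ℂ) * z ^ 2 + (g 1 1 - g 0 0) * z - g 0 1) =
      ((g 1 0 * (z.re ^ 2 - z.im ^ 2) + (g 1 1 - g 0 0) * z.re - g 0 1) ^ 2 +
        (2 * g 1 0 * z.re * z.im + (g 1 1 - g 0 0) * z.im) ^ 2) := by
    rw [Complex.normSq_apply]
    simp [pow_two]
    ring
  rw [h2]
  field_simp
  ring

lemma cosh_dist_I_smul (g : SL(2, ℝ)) :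
    2 * Real.cosh (dist UpperHalfPlane.I (g • UpperHalfPlane.I)) =
      g 0 0 ^ 2 + g 0 1 ^ 2 + g 1 0 ^ 2 + g 1 1 ^ 2 := by
  have h := sinh_half_dist_smul_sq g UpperHalfPlane.I
  have h2 := Real.cosh_two_mul (dist UpperHalfPlane.I (g • UpperHalfPlane.I) / 2)
  rw [Real.cosh_sq, h, mul_div_cancel₀ _ (two_ne_zero)] at h2
  rw [h2]
  simp
  linear_combination -2 * sl_det g

lemma dist_le_iff_sinh_sq {z w : ℍ} {ε : ℝ} (hε : 0 ≤ ε) :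
    dist z w ≤ ε ↔ Real.sinh (dist z w / 2) ^ 2 ≤ Real.sinh (ε / 2) ^ 2 := by
  rw [pow_le_pow_iff_left₀ (Real.sinh_nonneg_iff.mpr (by positivity))
    (Real.sinh_nonneg_iff.mpr (by positivity)) two_ne_zero, Real.sinh_le_sinh]
  constructor <;> intro h <;> linarith

lemma le_dist_iff_sinh_sq {z w : ℍ} {ε : ℝ} (hε : 0 ≤ ε) :
    ε ≤ dist z w ↔ Real.sinh (ε / 2) ^ 2 ≤ Real.sinh (dist z w / 2) ^ 2 := by
  rw [pow_le_pow_iff_left₀ (Real.sinh_nonneg_iff.mpr (by positivity))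
    (Real.sinh_nonneg_iff.mpr (by positivity)) two_ne_zero, Real.sinh_le_sinh]
  constructor <;> intro h <;> linarith

lemma sl_dist_smul (g : SL(2, ℝ)) (z w : ℍ) : dist (g • z) (g • w) = dist z w :=
  dist_smul g z w

lemma dist_smul_mul_le (g h : SL(2, ℝ)) (z : ℍ) :
    dist z ((g * h) • z) ≤ dist z (g • z) + dist z (h • z) := by
  rw [mul_smul, ← sl_dist_smul g z (h • z)]
  exact dist_triangle _ _ _

lemma dist_smul_inv (g : SL(2, ℝ)) (z : ℍ) : dist z (g⁻¹ • z) = dist z (g • z) := by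
  rw [← sl_dist_smul g z (g⁻¹ • z), smul_inv_smul, dist_comm]

lemma dist_conj_smul (u g : SL(2, ℝ)) (z : ℍ) :
    dist z ((u * g * u⁻¹) • z) = dist (u⁻¹ • z) (g • (u⁻¹ • z)) := by
  rw [← sl_dist_smul u (u⁻¹ • z), smul_inv_smul, ← mul_smul, ← mul_smul, mul_assoc]

lemma dist_smul_le_of_dist (g : SL(2, ℝ)) (z w : ℍ) :
    dist z (g • z) ≤ 2 * dist z w + dist w (g • w) := by
  calc dist z (g • z) ≤ dist z w + dist w (g • w) + dist (g • w) (g • z) := dist_triangle4 _ _ _ _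
    _ = _ := by rw [sl_dist_smul, dist_comm w z]; ring

lemma smul_I_eq_iff {g : SL(2, ℝ)} :
    g • UpperHalfPlane.I = UpperHalfPlane.I ↔ g 0 0 = g 1 1 ∧ g 0 1 = -g 1 0 := by
  rw [eq_comm, ← dist_eq_zero]
  have h := sinh_half_dist_smul_sq g UpperHalfPlane.I
  simp at h
  constructor
  · intro h0
    rw [h0] at h
    simp at h
    have : 0 = (-g 1 0 - g 0 1) ^ 2 + (g 1 1 - g 0 0) ^ 2 := by linarith
    constructor <;> nlinarith [sq_nonneg (-g 1 0 - g 0 1), sq_nonneg (g 1 1 - g 0 0)]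
  · rintro ⟨h1, h2⟩
    rw [h1, h2] at h
    simpa using h

/-- After moving `p` to `I`, fixing the point is a pair of linear conditions on the matrix; they
pass from `P` to `s + t P`. -/
lemma smul_eq_iff_commute_of_fixed {P g : SL(2, ℝ)} {p : ℍ} (hP : NonTriv P) (hp : P • p = p)
    (h : P * g = g * P) : g • p = p := by
  obtain ⟨u, rfl⟩ : ∃ u : SL(2, ℝ), u • UpperHalfPlane.I = p :=
    ⟨p.toSL2R, UpperHalfPlane.toSL2R_smul_I p⟩
  have h1 : (u⁻¹ * P * u) • UpperHalfPlane.I = UpperHalfPlane.I := by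
    rw [mul_smul, mul_smul, hp, inv_smul_smul]
  have h2 : (u⁻¹ * P * u) * (u⁻¹ * g * u) = (u⁻¹ * g * u) * (u⁻¹ * P * u) := by
    calc _ = u⁻¹ * (P * g) * u := by group
      _ = _ := by rw [h]; group
  have hn : NonTriv (u⁻¹ * P * u) := by simpa using hP.conj u⁻¹
  have h3 : (u⁻¹ * g * u) • UpperHalfPlane.I = UpperHalfPlane.I := by
    obtain ⟨s, t, e1, e2, e3, e4⟩ := exists_eq_of_commute hn h2
    rw [smul_I_eq_iff] at h1 ⊢
    rw [e1, e2, e3, e4, h1.1, h1.2]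
    exact ⟨rfl, by ring⟩
  rw [mul_smul, mul_smul, inv_smul_eq_iff] at h3
  exact h3

/-- Nontrivial elements with a fixed point in the plane are elliptic. -/
lemma tr_sq_lt_of_fixed {P : SL(2, ℝ)} {p : ℍ} (hP : NonTriv P) (hp : P • p = p) :
    tr P ^ 2 < 4 := by
  obtain ⟨u, rfl⟩ : ∃ u : SL(2, ℝ), u • UpperHalfPlane.I = p :=
    ⟨p.toSL2R, UpperHalfPlane.toSL2R_smul_I p⟩
  have h1 : (u⁻¹ * P * u) • UpperHalfPlane.I = UpperHalfPlane.I := by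
    rw [mul_smul, mul_smul, hp, inv_smul_smul]
  have hn : NonTriv (u⁻¹ * P * u) := by simpa using hP.conj u⁻¹
  have ht : tr (u⁻¹ * P * u) = tr P := by simpa using tr_conj u⁻¹ P
  rw [← ht]
  rw [smul_I_eq_iff] at h1
  have hd := sl_det (u⁻¹ * P * u)
  rw [nonTriv_iff] at hn
  have : (u⁻¹ * P * u) 1 0 ≠ 0 := fun h => hn ⟨by rw [h1.2, h, neg_zero], h, h1.1⟩
  have := sq_pos_of_ne_zero this
  rw [h1.1, h1.2] at hd
  unfold tr
  rw [h1.1]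
  nlinarith

lemma fixed_unique {P : SL(2, ℝ)} {p q : ℍ} (hP : NonTriv P) (hp : P • p = p) (hq : P • q = q) :
    p = q := by
  obtain ⟨u, rfl⟩ : ∃ u : SL(2, ℝ), u • UpperHalfPlane.I = p :=
    ⟨p.toSL2R, UpperHalfPlane.toSL2R_smul_I p⟩
  have h1 : (u⁻¹ * P * u) • UpperHalfPlane.I = UpperHalfPlane.I := by
    rw [mul_smul, mul_smul, hp, inv_smul_smul]
  have h2 : (u⁻¹ * P * u) • (u⁻¹ • q) = u⁻¹ • q := by
    rw [mul_smul, mul_smul, smul_inv_smul, hq]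
  have hn : NonTriv (u⁻¹ * P * u) := by simpa using hP.conj u⁻¹
  rw [smul_I_eq_iff] at h1
  generalize u⁻¹ * P * u = R at *
  suffices u⁻¹ • q = UpperHalfPlane.I by rw [← this, smul_inv_smul]
  generalize u⁻¹ • q = w at *
  have h := sinh_half_dist_smul_sq R w
  rw [h2, dist_self] at h
  have hy := w.im_pos
  have hc : R 1 0 ≠ 0 := fun h => nonTriv_iff.mp hn ⟨by rw [h1.2, h, neg_zero], h, h1.1⟩
  rw [h1.1, h1.2, zero_div, Real.sinh_zero, zero_pow two_ne_zero, eq_comm, div_eq_zero_iff] at h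
  simp at h
  rcases h with h | h
  · have h3 : (R 1 0 * (w.re ^ 2 - w.im ^ 2) + R 1 0) = 0 := by nlinarith
    have h4 : 2 * R 1 0 * w.re * w.im = 0 := by nlinarith
    have h5 : w.re = 0 := by
      simpa [hc, hy.ne'] using h4
    have h6 : w.im ^ 2 = 1 := by
      have : R 1 0 * (1 - w.im ^ 2) = 0 := by rw [h5] at h3; linarith
      have := (mul_eq_zero.mp this).resolve_left hc
      linarith
    have h7 : w.im = 1 := by nlinarith
    apply UpperHalfPlane.ext
    apply Complex.ext <;> simp [h5, h7]
  · exact absurd h hy.ne'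

end Geometry

/-! ### Discrete groups: an element commuting with its own conjugate. -/

section Margulis

/-- A subgroup of `SL(2, ℝ)` acting properly discontinuously on the plane. -/
def ActsDiscretely (Γ : Subgroup SL(2, ℝ)) : Prop :=
  ∀ (z : ℍ) (R : ℝ), {γ : SL(2, ℝ) | γ ∈ Γ ∧ dist z (γ • z) ≤ R}.Finite

lemma actsDiscretely_of_discrete {Γ : Subgroup SL(2, ℝ)} (h : DiscreteTopology Γ) :
    ActsDiscretely Γ := by
  intro z R
  have := ProperlyDiscontinuousSMul.finite_disjoint_inter_image (Γ := Γ)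
    (isCompact_singleton (x := z)) (isCompact_closedBall z R)
  refine (this.image Subtype.val).subset ?_
  rintro γ ⟨h1, h2⟩
  refine ⟨⟨γ, h1⟩, ⟨γ • z, ⟨z, rfl, rfl⟩, ?_⟩, rfl⟩
  rwa [Metric.mem_closedBall, dist_comm]

/-- The subgroup generated by `Γ` and `-1`. -/
def withNegOne (Γ : Subgroup SL(2, ℝ)) : Subgroup SL(2, ℝ) where
  carrier := {g | g ∈ Γ ∨ -g ∈ Γ}
  one_mem' := Or.inl Γ.one_mem
  mul_mem' := by
    rintro a b (ha | ha) (hb | hb)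
    · exact Or.inl (Γ.mul_mem ha hb)
    · exact Or.inr (by simpa using Γ.mul_mem ha hb)
    · exact Or.inr (by simpa using Γ.mul_mem ha hb)
    · exact Or.inl (by simpa using Γ.mul_mem ha hb)
  inv_mem' := by
    rintro a (ha | ha)
    · exact Or.inl (Γ.inv_mem ha)
    · refine Or.inr ?_
      have := Γ.inv_mem ha
      rwa [inv_neg] at this

lemma ActsDiscretely.withNegOne {Γ : Subgroup SL(2, ℝ)} (h : ActsDiscretely Γ) :
    ActsDiscretely (withNegOne Γ) := by
  intro z R
  refine ((h z R).union ((h z R).image (fun g => -g))).subset ?_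
  rintro γ ⟨h1 | h1, h2⟩
  · exact Or.inl ⟨h1, h2⟩
  · exact Or.inr ⟨-γ, ⟨h1, by rwa [sl_neg_smul]⟩, neg_neg γ⟩

lemma dist_le_two_mul_cosh (z w : ℍ) : dist z w ≤ 2 * Real.cosh (dist z w) := by
  rw [Real.cosh_eq]
  have := Real.add_one_le_exp (dist z w)
  have := Real.exp_pos (-dist z w)
  linarith

lemma coe_conj_pow {A B : SL(2, ℝ)} {σ t : ℝ}
    (h : ((B * A * B⁻¹ : SL(2, ℝ)) : Matrix (Fin 2) (Fin 2) ℝ) =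
      σ • 1 + t • ((A : Matrix (Fin 2) (Fin 2) ℝ) - σ • 1)) (n : ℕ) :
    ((B ^ n * A * (B ^ n)⁻¹ : SL(2, ℝ)) : Matrix (Fin 2) (Fin 2) ℝ) =
      σ • 1 + t ^ n • ((A : Matrix (Fin 2) (Fin 2) ℝ) - σ • 1) := by
  have hB : (B : Matrix (Fin 2) (Fin 2) ℝ) * ((B⁻¹ : SL(2, ℝ)) : Matrix (Fin 2) (Fin 2) ℝ) = 1 := by
    rw [← Matrix.SpecialLinearGroup.coe_mul, mul_inv_cancel, Matrix.SpecialLinearGroup.coe_one]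
  induction n with
  | zero => simp
  | succ n ih =>
    have e : B ^ (n + 1) * A * (B ^ (n + 1))⁻¹ = B * (B ^ n * A * (B ^ n)⁻¹) * B⁻¹ := by
      rw [pow_succ']; group
    have h' : (B : Matrix (Fin 2) (Fin 2) ℝ) * A * ((B⁻¹ : SL(2, ℝ)) : Matrix (Fin 2) (Fin 2) ℝ) =
        σ • 1 + t • ((A : Matrix (Fin 2) (Fin 2) ℝ) - σ • 1) := by
      rw [← h, Matrix.SpecialLinearGroup.coe_mul, Matrix.SpecialLinearGroup.coe_mul]
    rw [e, Matrix.SpecialLinearGroup.coe_mul, Matrix.SpecialLinearGroup.coe_mul, ih]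
    simp only [mul_add, add_mul, mul_sub, sub_mul, Algebra.mul_smul_comm, Algebra.smul_mul_assoc,
      mul_one, hB, h']
    rw [add_sub_cancel_left, smul_smul, pow_succ]

/-- The conjugates of `A` by powers of `B` would be infinitely many distinct elements with bounded
entries, so with bounded displacement of `I`. -/
lemma not_contracting_conj {Γ : Subgroup SL(2, ℝ)} (hΓ : ActsDiscretely Γ) {A B : SL(2, ℝ)}
    (hA : A ∈ Γ) (hB : B ∈ Γ) (hn : NonTriv A) {σ t : ℝ} (ht0 : 0 < t) (ht1 : t < 1)
    (h : ((B * A * B⁻¹ : SL(2, ℝ)) : Matrix (Fin 2) (Fin 2) ℝ) =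
      σ • 1 + t • ((A : Matrix (Fin 2) (Fin 2) ℝ) - σ • 1)) : False := by
  have hpow := coe_conj_pow h
  have e : ∀ n i j, (B ^ n * A * (B ^ n)⁻¹) i j =
      σ * (1 : Matrix (Fin 2) (Fin 2) ℝ) i j +
        t ^ n * (A i j - σ * (1 : Matrix (Fin 2) (Fin 2) ℝ) i j) := by
    intro n i j
    rw [hpow n]; simp
  set M : Fin 2 → Fin 2 → ℝ := fun i j => |σ * (1 : Matrix (Fin 2) (Fin 2) ℝ) i j| +
    |A i j - σ * (1 : Matrix (Fin 2) (Fin 2) ℝ) i j| with hM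
  have hb : ∀ n i j, (B ^ n * A * (B ^ n)⁻¹) i j ^ 2 ≤ M i j ^ 2 := by
    intro n i j
    apply sq_le_sq'
    · rw [e, hM]
      have h1 := neg_abs_le (σ * (1 : Matrix (Fin 2) (Fin 2) ℝ) i j)
      have h2 : |t ^ n * (A i j - σ * (1 : Matrix (Fin 2) (Fin 2) ℝ) i j)| ≤
          |A i j - σ * (1 : Matrix (Fin 2) (Fin 2) ℝ) i j| := by
        rw [abs_mul, abs_of_pos (pow_pos ht0 n)]
        exact mul_le_of_le_one_left (abs_nonneg _) (pow_le_one₀ ht0.le ht1.le)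
      have := neg_abs_le (t ^ n * (A i j - σ * (1 : Matrix (Fin 2) (Fin 2) ℝ) i j))
      simp only
      linarith
    · rw [e, hM]
      have h1 := le_abs_self (σ * (1 : Matrix (Fin 2) (Fin 2) ℝ) i j)
      have h2 : |t ^ n * (A i j - σ * (1 : Matrix (Fin 2) (Fin 2) ℝ) i j)| ≤
          |A i j - σ * (1 : Matrix (Fin 2) (Fin 2) ℝ) i j| := by
        rw [abs_mul, abs_of_pos (pow_pos ht0 n)]
        exact mul_le_of_le_one_left (abs_nonneg _) (pow_le_one₀ ht0.le ht1.le)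
      have := le_abs_self (t ^ n * (A i j - σ * (1 : Matrix (Fin 2) (Fin 2) ℝ) i j))
      simp only
      linarith
  have hfin := hΓ UpperHalfPlane.I (M 0 0 ^ 2 + M 0 1 ^ 2 + M 1 0 ^ 2 + M 1 1 ^ 2)
  refine Set.infinite_of_injective_forall_mem (f := fun n : ℕ => B ^ n * A * (B ^ n)⁻¹)
    ?_ ?_ hfin
  · intro n m hnm
    simp only at hnm
    by_contra hne
    have htn : t ^ n ≠ t ^ m := fun h => hne ((pow_right_strictAnti₀ ht0 ht1).injective h)
    have hz : ∀ i j, A i j - σ * (1 : Matrix (Fin 2) (Fin 2) ℝ) i j = 0 := by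
      intro i j
      have h1 := e n i j
      rw [hnm, e m i j] at h1
      have h2 : (t ^ n - t ^ m) * (A i j - σ * (1 : Matrix (Fin 2) (Fin 2) ℝ) i j) = 0 := by
        linarith
      exact (mul_eq_zero.mp h2).resolve_left (sub_ne_zero.mpr htn)
    apply nonTriv_iff.mp hn
    have h00 := hz 0 0
    have h01 := hz 0 1
    have h10 := hz 1 0
    have h11 := hz 1 1
    simp at h00 h01 h10 h11
    exact ⟨h01, h10, by linarith⟩
  · intro n
    refine ⟨Γ.mul_mem (Γ.mul_mem (Γ.pow_mem hB n) hA) (Γ.inv_mem (Γ.pow_mem hB n)), ?_⟩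
    refine (dist_le_two_mul_cosh _ _).trans ?_
    rw [cosh_dist_I_smul]
    have := hb n
    linarith [this 0 0, this 0 1, this 1 0, this 1 1]

/-- A nonzero nilpotent matrix is `± v (J v)ᵀ`, with `J` the symplectic matrix; conjugation in
`SL(2, ℝ)` acts on `v` and preserves the sign. -/
lemma parabolic_conj_factor_pos {p q r s x y w t : ℝ} (hdet : p * s - q * r = 1)
    (hN : x ^ 2 + y * w = 0) (hne : ¬ (y = 0 ∧ w = 0))
    (e00 : p * x + q * w = t * (x * p + y * r)) (e01 : p * y - q * x = t * (x * q + y * s))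
    (e10 : r * x + s * w = t * (w * p - x * r)) (e11 : r * y - s * x = t * (w * q - x * s)) :
    0 < t := by
  by_cases hw : w = 0
  · subst hw
    have hx : x = 0 := by nlinarith
    subst hx
    have hy : y ≠ 0 := fun h => hne ⟨h, rfl⟩
    have hr : r = 0 := by
      have : r * y = 0 := by linarith
      exact (mul_eq_zero.mp this).resolve_right hy
    have hp : p = t * s := by
      have : (p - t * s) * y = 0 := by linarith
      linarith [(mul_eq_zero.mp this).resolve_right hy]
    subst hr hp
    by_contra h
    push Not at h
    nlinarith [sq_nonneg s]
  · have e : p * x * w + q * w ^ 2 = x * (r * x + s * w) := by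
      linear_combination w * e00 + t * r * hN - x * e10
    have h1 : t * (p * w - x * r) ^ 2 = w ^ 2 := by
      linear_combination -(p * w - x * r) * e10 + w ^ 2 * hdet + r * e
    have h2 := sq_pos_of_ne_zero hw
    by_contra h
    push Not at h
    nlinarith [sq_nonneg (p * w - x * r)]

lemma coe_ext {g : SL(2, ℝ)} {M : Matrix (Fin 2) (Fin 2) ℝ} (h00 : g 0 0 = M 0 0)
    (h01 : g 0 1 = M 0 1) (h10 : g 1 0 = M 1 0) (h11 : g 1 1 = M 1 1) :
    (g : Matrix (Fin 2) (Fin 2) ℝ) = M := by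
  ext i j
  fin_cases i <;> fin_cases j <;> assumption

/-- In a discrete group, an element commuting with its conjugate by `B` either commutes with `B`,
or is hyperbolic and inverted by the half-turn `B`. -/
lemma commute_or_inverted {Γ : Subgroup SL(2, ℝ)} (hΓ : ActsDiscretely Γ) {A B : SL(2, ℝ)}
    (hA : A ∈ Γ) (hB : B ∈ Γ) (hn : NonTriv A) (h : A * (B * A * B⁻¹) = (B * A * B⁻¹) * A) :
    B * A = A * B ∨ (B * A * B⁻¹ = A⁻¹ ∧ tr B = 0 ∧ 4 < tr A ^ 2) := by
  obtain ⟨s, t, e1, e2, e3, e4⟩ := exists_eq_of_commute hn h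
  have htr := tr_conj B A
  have hdA := sl_det A
  have hdX := sl_det (B * A * B⁻¹)
  have hdB := sl_det B
  -- The conjugate is `s + t A`. Equality of traces determines `s`, and the determinant then forces
  -- `t = ±1` unless `A` is parabolic.
  have hs : 2 * s = (1 - t) * tr A := by
    have : tr (B * A * B⁻¹) = 2 * s + t * tr A := by
      simp only [tr, e1, e4]; ring
    linarith
  have hst : (1 - t ^ 2) * (tr A ^ 2 - 4) = 0 := by
    rw [e1, e2, e3, e4] at hdX
    have h1 : s ^ 2 + s * t * tr A + t ^ 2 = 1 := by
      unfold tr; linear_combination hdX - t ^ 2 * hdA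
    have hs' : s = (1 - t) * tr A / 2 := by linarith
    rw [hs'] at h1
    linear_combination 4 * h1
  have key : B * A = (B * A * B⁻¹) * B := by group
  by_cases hτ : tr A ^ 2 = 4
  · -- the parabolic case
    left
    set σ := tr A / 2 with hσ
    have hs' : s = (1 - t) * σ := by rw [hσ]; linarith
    have hX : ((B * A * B⁻¹ : SL(2, ℝ)) : Matrix (Fin 2) (Fin 2) ℝ) =
        σ • 1 + t • ((A : Matrix (Fin 2) (Fin 2) ℝ) - σ • 1) := by
      apply coe_ext
      · rw [e1, hs']; simp; ring
      · rw [e2]; simp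
      · rw [e3]; simp
      · rw [e4, hs']; simp; ring
    have ht : 0 < t := by
      have hx : A 1 1 - σ = -(A 0 0 - σ) := by rw [hσ]; unfold tr; ring
      have k := sl_ext_iff.mp key
      rw [sl_mul_apply B A, sl_mul_apply B A, sl_mul_apply B A, sl_mul_apply B A,
        sl_mul_apply _ B, sl_mul_apply _ B, sl_mul_apply _ B, sl_mul_apply _ B,
        e1, e2, e3, e4, hs'] at k
      obtain ⟨k1, k2, k3, k4⟩ := k
      have hx' : A 1 1 = 2 * σ - A 0 0 := by linarith
      refine parabolic_conj_factor_pos (x := A 0 0 - σ) (y := A 0 1) (w := A 1 0) (t := t) hdB ?_ ?_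
        ?_ ?_ ?_ ?_
      · have : σ ^ 2 = 1 := by rw [hσ]; linarith
        rw [hx'] at hdA
        linear_combination this - hdA
      · rintro ⟨h1, h2⟩
        refine nonTriv_iff.mp hn ⟨h1, h2, ?_⟩
        have : σ ^ 2 = 1 := by rw [hσ]; linarith
        rw [hx', h1] at hdA
        have h3 : (A 0 0 - σ) ^ 2 = 0 := by linear_combination this - hdA
        have h4 : A 0 0 - σ = 0 := by simpa using h3
        linarith
      · linear_combination k1
      · rw [hx'] at k2; linear_combination k2
      · rw [hx'] at k3; linear_combination k3
      · rw [hx'] at k4; linear_combination k4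
    rcases lt_trichotomy t 1 with h1 | h1 | h1
    · exact (not_contracting_conj hΓ hA hB hn ht h1 hX).elim
    · rw [h1] at hX
      have : B * A * B⁻¹ = A := by
        apply Subtype.ext
        rw [hX]; simp
      rw [this] at key; exact key
    -- Here `B⁻¹` contracts with factor `t⁻¹ < 1`.
    · exfalso
      refine not_contracting_conj hΓ hA (Γ.inv_mem hB) hn (σ := σ) (t := t⁻¹) (inv_pos.mpr ht)
        (inv_lt_one_of_one_lt₀ h1) ?_
      have hBB : ((B⁻¹ : SL(2, ℝ)) : Matrix (Fin 2) (Fin 2) ℝ) * (B : Matrix (Fin 2) (Fin 2) ℝ)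
          = 1 := by
        rw [← Matrix.SpecialLinearGroup.coe_mul, inv_mul_cancel, Matrix.SpecialLinearGroup.coe_one]
      have h2 : (A : Matrix (Fin 2) (Fin 2) ℝ) = σ • 1 + t •
          (((B⁻¹ * A * B⁻¹⁻¹ : SL(2, ℝ)) : Matrix (Fin 2) (Fin 2) ℝ) - σ • 1) := by
        have h3 : (A : Matrix (Fin 2) (Fin 2) ℝ) =
            ((B⁻¹ : SL(2, ℝ)) : Matrix (Fin 2) (Fin 2) ℝ) *
              ((B * A * B⁻¹ : SL(2, ℝ)) : Matrix (Fin 2) (Fin 2) ℝ) * B := by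
          rw [← Matrix.SpecialLinearGroup.coe_mul, ← Matrix.SpecialLinearGroup.coe_mul]
          rw [show B⁻¹ * (B * A * B⁻¹) * B = A by group]
        rw [h3, hX, inv_inv, Matrix.SpecialLinearGroup.coe_mul, Matrix.SpecialLinearGroup.coe_mul]
        simp only [mul_add, add_mul, mul_sub, sub_mul, Algebra.mul_smul_comm,
          Algebra.smul_mul_assoc, mul_one, hBB]
      generalize ((B⁻¹ * A * B⁻¹⁻¹ : SL(2, ℝ)) : Matrix (Fin 2) (Fin 2) ℝ) = Y at h2 ⊢
      rw [h2, add_sub_cancel_left, smul_smul, inv_mul_cancel₀ ht.ne', one_smul, add_sub_cancel]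
  · have ht : (1 - t) * (1 + t) = 0 := by
      have := (mul_eq_zero.mp hst).resolve_right (sub_ne_zero.mpr hτ)
      linarith
    rcases mul_eq_zero.mp ht with h1 | h1
    · left
      have ht : t = 1 := by linarith
      subst ht
      have hs : s = 0 := by linarith
      subst hs
      have : B * A * B⁻¹ = A := by
        rw [sl_ext_iff, e1, e2, e3, e4]
        refine ⟨?_, ?_, ?_, ?_⟩ <;> ring
      rw [this] at key; exact key
    · right
      have ht : t = -1 := by linarith
      subst ht
      have hs : s = tr A := by linarith
      subst hs
      have hinv : B * A * B⁻¹ = A⁻¹ := by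
        rw [sl_ext_iff, e1, e2, e3, e4, sl_inv_00, sl_inv_01, sl_inv_10, sl_inv_11]
        unfold tr
        refine ⟨?_, ?_, ?_, ?_⟩ <;> ring
      rw [hinv, sl_ext_iff] at key
      simp only [sl_mul_apply, sl_inv_00, sl_inv_01, sl_inv_10, sl_inv_11] at key
      obtain ⟨k1, k2, k3, k4⟩ := key
      have htB : tr B = 0 := by
        by_contra hB0
        apply nonTriv_iff.mp hn
        have q1 : A 0 1 * tr B = 0 := by unfold tr; linear_combination k2
        have q2 : A 1 0 * tr B = 0 := by unfold tr; linear_combination k3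
        have q3 : (A 0 0 - A 1 1) * tr B = 0 := by unfold tr; linear_combination k1 - k4
        exact ⟨(mul_eq_zero.mp q1).resolve_right hB0, (mul_eq_zero.mp q2).resolve_right hB0,
          sub_eq_zero.mp ((mul_eq_zero.mp q3).resolve_right hB0)⟩
      refine ⟨hinv, htB, ?_⟩
      by_contra hlt
      have hlt : tr A ^ 2 < 4 := lt_of_le_of_ne (not_lt.mp hlt) hτ
      have hD : (A 0 0 - A 1 1) ^ 2 + 4 * (A 0 1 * A 1 0) < 0 := by
        unfold tr at hlt; nlinarith
      have hB11 : B 1 1 = -B 0 0 := by unfold tr at htB; linarith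
      rw [hB11] at hdB
      have e5 : (A 0 0 - A 1 1) * B 0 0 = -(B 0 1 * A 1 0 + B 1 0 * A 0 1) := by
        linear_combination k1
      have e6 : (A 0 0 - A 1 1) ^ 2 * B 0 0 ^ 2 = (B 0 1 * A 1 0 + B 1 0 * A 0 1) ^ 2 := by
        rw [← mul_pow, e5]; ring
      have e7 : B 0 1 * B 1 0 = -1 - B 0 0 ^ 2 := by linarith
      -- If `A` were elliptic, both terms on the right would be nonpositive and the second negative,
      -- whereas the left side is a square.
      have e8 : (B 0 1 * A 1 0 - B 1 0 * A 0 1) ^ 2 =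
          ((A 0 0 - A 1 1) ^ 2 + 4 * (A 0 1 * A 1 0)) * B 0 0 ^ 2 + 4 * (A 0 1 * A 1 0) := by
        linear_combination -e6 - 4 * A 0 1 * A 1 0 * e7
      nlinarith [sq_nonneg (B 0 1 * A 1 0 - B 1 0 * A 0 1), sq_nonneg (B 0 0),
        sq_nonneg (A 0 0 - A 1 1)]

end Margulis

/-! ### Commutator contraction near the identity. -/

section Zassenhaus
open scoped Matrix.Norms.Frobenius

lemma frobenius_sq (M : Matrix (Fin 2) (Fin 2) ℝ) :
    ‖M‖ ^ 2 = M 0 0 ^ 2 + M 0 1 ^ 2 + M 1 0 ^ 2 + M 1 1 ^ 2 := by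
  rw [Matrix.frobenius_norm_def, ← Real.sqrt_eq_rpow, Real.sq_sqrt (by positivity)]
  simp [Fin.sum_univ_two]
  ring

lemma frobenius_inv (g : SL(2, ℝ)) :
    ‖((g⁻¹ : SL(2, ℝ)) : Matrix (Fin 2) (Fin 2) ℝ)‖ = ‖(g : Matrix (Fin 2) (Fin 2) ℝ)‖ := by
  rw [← pow_left_inj₀ (norm_nonneg _) (norm_nonneg _) two_ne_zero, frobenius_sq, frobenius_sq,
    sl_inv_00, sl_inv_01, sl_inv_10, sl_inv_11]
  ring

lemma norm_le_of_near_one {g : SL(2, ℝ)}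
    (h : ‖(g : Matrix (Fin 2) (Fin 2) ℝ) - 1‖ ≤ 1 / 8) :
    ‖(g : Matrix (Fin 2) (Fin 2) ℝ)‖ ≤ 8 / 5 := by
  -- The Frobenius norm of the identity is `√2 < 59/40`, and `59/40 + 1/8 = 8/5`.
  have h1 : ‖(1 : Matrix (Fin 2) (Fin 2) ℝ)‖ ≤ 59 / 40 := by
    have := frobenius_sq 1
    simp at this
    nlinarith [norm_nonneg (1 : Matrix (Fin 2) (Fin 2) ℝ)]
  calc ‖(g : Matrix (Fin 2) (Fin 2) ℝ)‖ = ‖((g : Matrix (Fin 2) (Fin 2) ℝ) - 1) + 1‖ := by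
        rw [sub_add_cancel]
    _ ≤ _ := norm_add_le _ _
    _ ≤ _ := by linarith

/-- From `a b a⁻¹ b⁻¹ - 1 = [a - 1, b - 1] a⁻¹ b⁻¹`, the factor obtained is `2 · (1/8) · (8/5)² =
16/25 < 2/3`. -/
lemma norm_commutator_sub_one_le {A B : SL(2, ℝ)}
    (hA : ‖(A : Matrix (Fin 2) (Fin 2) ℝ) - 1‖ ≤ 1 / 8)
    (hB : ‖(B : Matrix (Fin 2) (Fin 2) ℝ) - 1‖ ≤ 1 / 8) :
    ‖((A * (B * A⁻¹ * B⁻¹) : SL(2, ℝ)) : Matrix (Fin 2) (Fin 2) ℝ) - 1‖ ≤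
      2 / 3 * ‖(B : Matrix (Fin 2) (Fin 2) ℝ) - 1‖ := by
  set a := (A : Matrix (Fin 2) (Fin 2) ℝ) with ha
  set b := (B : Matrix (Fin 2) (Fin 2) ℝ) with hb
  set a' := ((A⁻¹ : SL(2, ℝ)) : Matrix (Fin 2) (Fin 2) ℝ) with ha'
  set b' := ((B⁻¹ : SL(2, ℝ)) : Matrix (Fin 2) (Fin 2) ℝ) with hb'
  have haa : a * a' = 1 := by
    rw [ha, ha', ← Matrix.SpecialLinearGroup.coe_mul, mul_inv_cancel,
      Matrix.SpecialLinearGroup.coe_one]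
  have hbb : b * b' = 1 := by
    rw [hb, hb', ← Matrix.SpecialLinearGroup.coe_mul, mul_inv_cancel,
      Matrix.SpecialLinearGroup.coe_one]
  have e : ((A * (B * A⁻¹ * B⁻¹) : SL(2, ℝ)) : Matrix (Fin 2) (Fin 2) ℝ) - 1 =
      ((a - 1) * (b - 1) - (b - 1) * (a - 1)) * (a' * b') := by
    have h1 : (a - 1) * (b - 1) - (b - 1) * (a - 1) = a * b - b * a := by noncomm_ring
    have h2 : b * a * (a' * b') = 1 := by
      rw [← mul_assoc, mul_assoc b a a', haa, mul_one, hbb]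
    rw [h1, sub_mul, h2]
    simp only [Matrix.SpecialLinearGroup.coe_mul, mul_assoc]
    rfl
  have hna : ‖a'‖ ≤ 8 / 5 := (frobenius_inv A).trans_le (norm_le_of_near_one hA)
  have hnb : ‖b'‖ ≤ 8 / 5 := (frobenius_inv B).trans_le (norm_le_of_near_one hB)
  have hab : ‖a' * b'‖ ≤ 8 / 5 * (8 / 5) :=
    (norm_mul_le _ _).trans (mul_le_mul hna hnb (norm_nonneg _) (by norm_num))
  have hc : ‖(a - 1) * (b - 1) - (b - 1) * (a - 1)‖ ≤ 2 * (1 / 8 * ‖b - 1‖) := by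
    refine (norm_sub_le _ _).trans ?_
    have h1 : ‖(a - 1) * (b - 1)‖ ≤ 1 / 8 * ‖b - 1‖ :=
      (norm_mul_le _ _).trans (mul_le_mul_of_nonneg_right hA (norm_nonneg _))
    have h2 : ‖(b - 1) * (a - 1)‖ ≤ 1 / 8 * ‖b - 1‖ := by
      refine (norm_mul_le _ _).trans ?_
      rw [mul_comm]
      exact mul_le_mul_of_nonneg_right hA (norm_nonneg _)
    linarith
  rw [e]
  calc _ ≤ ‖(a - 1) * (b - 1) - (b - 1) * (a - 1)‖ * ‖a' * b'‖ := norm_mul_le _ _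
    _ ≤ 2 * (1 / 8 * ‖b - 1‖) * (8 / 5 * (8 / 5)) :=
        mul_le_mul hc hab (norm_nonneg _) (by positivity)
    _ ≤ _ := by nlinarith [norm_nonneg (b - 1)]

/-- The distance of `g` from the identity, seen from the point `z`. -/
noncomputable def devAt (z : ℍ) (g : SL(2, ℝ)) : ℝ :=
  ‖((z.toSL2R⁻¹ * g * z.toSL2R : SL(2, ℝ)) : Matrix (Fin 2) (Fin 2) ℝ) - 1‖

lemma toSL2R_conj_dist (z : ℍ) (g : SL(2, ℝ)) :
    dist UpperHalfPlane.I ((z.toSL2R⁻¹ * g * z.toSL2R) • UpperHalfPlane.I) = dist z (g • z) := by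
  have := dist_conj_smul z.toSL2R⁻¹ g UpperHalfPlane.I
  rwa [inv_inv, UpperHalfPlane.toSL2R_smul_I] at this

lemma tr_toSL2R_conj (z : ℍ) (g : SL(2, ℝ)) : tr (z.toSL2R⁻¹ * g * z.toSL2R) = tr g := by
  simpa using tr_conj z.toSL2R⁻¹ g

/-- The trace controls what the displacement does not: with trace at least 2, a small displacement
means closeness to the identity, while an element of trace 0 has deviation at least 2 from every
point. -/
lemma devAt_sq (z : ℍ) (g : SL(2, ℝ)) :
    devAt z g ^ 2 = 2 * Real.cosh (dist z (g • z)) + 2 - 2 * tr g := by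
  rw [devAt, frobenius_sq, ← toSL2R_conj_dist, cosh_dist_I_smul, ← tr_toSL2R_conj z g]
  simp [tr]
  ring

lemma devAt_nonneg (z : ℍ) (g : SL(2, ℝ)) : 0 ≤ devAt z g := norm_nonneg _

lemma devAt_eq_zero {z : ℍ} {g : SL(2, ℝ)} (h : devAt z g = 0) : g = 1 := by
  rw [devAt, norm_eq_zero, sub_eq_zero] at h
  have h1 : z.toSL2R⁻¹ * g * z.toSL2R = 1 := Subtype.ext h
  have h2 : g = z.toSL2R * (z.toSL2R⁻¹ * g * z.toSL2R) * z.toSL2R⁻¹ := by group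
  rw [h2, h1]; group

lemma devAt_commutator_le {z : ℍ} {A B : SL(2, ℝ)} (hA : devAt z A ≤ 1 / 8)
    (hB : devAt z B ≤ 1 / 8) : devAt z (A * (B * A⁻¹ * B⁻¹)) ≤ 2 / 3 * devAt z B := by
  have := norm_commutator_sub_one_le hA hB
  unfold devAt
  convert this using 5
  group

lemma dist_le_of_devAt {z : ℍ} {g : SL(2, ℝ)} (h : devAt z g ≤ 1 / 8) :
    dist z (g • z) ≤ 64 / 25 := by
  have h1 := norm_le_of_near_one h
  have h2 : 2 * Real.cosh (dist z (g • z)) ≤ (8 / 5) ^ 2 := by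
    rw [← toSL2R_conj_dist, cosh_dist_I_smul, ← frobenius_sq]
    exact pow_le_pow_left₀ (norm_nonneg _) h1 2
  have := dist_le_two_mul_cosh z (g • z)
  norm_num at h2
  linarith

/-- Two elements of a discrete group that are close to the identity commute. -/
lemma commute_of_devAt {Γ : Subgroup SL(2, ℝ)} (hΓ : ActsDiscretely Γ) {z : ℍ} {A B : SL(2, ℝ)}
    (hA : A ∈ Γ) (hB : B ∈ Γ) (hdA : devAt z A ≤ 1 / 8) (hdB : devAt z B ≤ 1 / 8) :
    B * A = A * B := by
  by_cases hn : NonTriv A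
  swap
  · unfold NonTriv at hn
    rw [not_and_or, not_not, not_not] at hn
    rcases hn with rfl | rfl <;> simp
  -- Iterated commutators with `A`, starting from `B`: their deviation decays geometrically while
  -- they stay in a finite set, so some iterate is trivial.
  let F : SL(2, ℝ) → SL(2, ℝ) := fun X => A * (X * A⁻¹ * X⁻¹)
  let b : ℕ → SL(2, ℝ) := fun n => F^[n] B
  have hb0 : b 0 = B := rfl
  have hbs : ∀ n, b (n + 1) = A * (b n * A⁻¹ * (b n)⁻¹) := fun n =>
    Function.iterate_succ_apply' F n B
  have hmem : ∀ n, b n ∈ Γ := by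
    intro n
    induction n with
    | zero => exact hB
    | succ n ih =>
      rw [hbs]
      exact Γ.mul_mem hA (Γ.mul_mem (Γ.mul_mem ih (Γ.inv_mem hA)) (Γ.inv_mem ih))
  have hdev : ∀ n, devAt z (b n) ≤ (2 / 3) ^ n * (1 / 8) := by
    intro n
    induction n with
    | zero => rw [hb0]; simpa using hdB
    | succ n ih =>
      have h8 : devAt z (b n) ≤ 1 / 8 := ih.trans (mul_le_of_le_one_left (by norm_num)
        (pow_le_one₀ (by norm_num) (by norm_num)))
      rw [hbs, pow_succ']
      refine (devAt_commutator_le hdA h8).trans ?_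
      rw [mul_assoc]
      exact mul_le_mul_of_nonneg_left ih (by norm_num)
  have h8 : ∀ n, devAt z (b n) ≤ 1 / 8 := fun n => (hdev n).trans
    (mul_le_of_le_one_left (by norm_num) (pow_le_one₀ (by norm_num) (by norm_num)))
  have hone : ∃ n, b n = 1 := by
    by_contra hne
    push Not at hne
    have hfin := hΓ z (64 / 25)
    have hrange : (Set.range b).Finite := hfin.subset (by
      rintro _ ⟨n, rfl⟩
      exact ⟨hmem n, dist_le_of_devAt (h8 n)⟩)
    obtain ⟨_, ⟨m, rfl⟩, hm⟩ := hrange.exists_minimalFor (devAt z) _ (Set.range_nonempty b)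
    have hpos : 0 < devAt z (b m) :=
      lt_of_le_of_ne (devAt_nonneg _ _) fun h => hne m (devAt_eq_zero h.symm)
    have h1 : devAt z (b (m + 1)) ≤ 2 / 3 * devAt z (b m) := by
      rw [hbs]; exact devAt_commutator_le hdA (h8 m)
    have h2 := hm ⟨m + 1, rfl⟩ (by linarith)
    linarith
  obtain ⟨n, hn1⟩ := hone
  -- Descent: if `[A, b n]` commutes with `A`, then `A` commutes with its conjugate by `b n`, hence
  -- with `b n` itself. The half-turn alternative fails since `b n` is close to the identity.
  have hdown : ∀ n, b n * A = A * b n → b 0 * A = A * b 0 := by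
    intro n
    induction n with
    | zero => exact id
    | succ n ih =>
      intro h
      apply ih
      have h1 : A * (b n * A * (b n)⁻¹) = (b n * A * (b n)⁻¹) * A := by
        rw [hbs] at h
        have h2 : (b n * A⁻¹ * (b n)⁻¹) * A = A * (b n * A⁻¹ * (b n)⁻¹) := by
          apply mul_left_cancel (a := A)
          rw [← mul_assoc]; exact h
        have e : b n * A * (b n)⁻¹ = (b n * A⁻¹ * (b n)⁻¹)⁻¹ := by group
        rw [e]
        have h3 : Commute (b n * A⁻¹ * (b n)⁻¹) A := h2
        exact h3.inv_left.symm
      rcases commute_or_inverted hΓ hA (hmem n) hn h1 with h2 | ⟨-, h2, -⟩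
      · exact h2
      · exfalso
        have h3 := devAt_sq z (b n)
        rw [h2] at h3
        have := Real.one_le_cosh (dist z (b n • z))
        have := h8 n
        nlinarith [devAt_nonneg z (b n)]
  rw [← hb0]
  exact hdown n (by rw [hn1]; simp)

/-- The squared deviation is at most `2 (cosh d - 1)`, where `d` is the displacement, and for `d ≤
1/10` this is at most `2/199 < 1/64`. -/
lemma devAt_le_of_two_le_tr {z : ℍ} {g : SL(2, ℝ)} (ht : 2 ≤ tr g)
    (hd : dist z (g • z) ≤ 1 / 10) : devAt z g ≤ 1 / 8 := by
  have h1 : Real.cosh (dist z (g • z)) ≤ 200 / 199 := by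
    refine (Real.cosh_le_exp_half_sq _).trans ?_
    have h2 : dist z (g • z) ^ 2 / 2 ≤ 1 / 200 := by
      nlinarith [dist_nonneg (x := z) (y := g • z)]
    refine (Real.exp_le_exp.mpr h2).trans ?_
    have h3 := Real.add_one_le_exp (-(1 / 200) : ℝ)
    rw [Real.exp_neg] at h3
    have h4 := Real.exp_pos (1 / 200 : ℝ)
    have h5 : (Real.exp (1 / 200))⁻¹ * Real.exp (1 / 200) = 1 := inv_mul_cancel₀ h4.ne'
    nlinarith
  have h2 := devAt_sq z g
  nlinarith [devAt_nonneg z g]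

end Zassenhaus

/-! ### The Margulis lemma. -/

section MargulisLemma

lemma dist_conj_le (g h : SL(2, ℝ)) (z : ℍ) :
    dist z ((g * h * g⁻¹) • z) ≤ 2 * dist z (g • z) + dist z (h • z) := by
  have h1 := dist_smul_mul_le (g * h) g⁻¹ z
  have h2 := dist_smul_mul_le g h z
  rw [dist_smul_inv] at h1
  linarith

/-- If `P` is not elliptic, it and its conjugate by `g` are close to the identity, so they commute.
If `P` is elliptic, the same argument for `H = [P, g]` and its conjugate by `P` makes `H` commute
with `P`, since `tr P ≠ 0`. As `tr H ≥ 2`, `H` is not elliptic, so it must be trivial. The constant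
1/60 keeps the displacement of `P H P⁻¹` below `(2 + 4)/60 = 1/10`. -/
lemma margulis_aux {Γ : Subgroup SL(2, ℝ)} (hΓ : ActsDiscretely Γ) {P g : SL(2, ℝ)}
    {z : ℍ} (hP : P ∈ Γ) (hg : g ∈ Γ) (hn : NonTriv P) (ht : 0 < tr P)
    (hdP : dist z (P • z) ≤ 1 / 60) (hdg : dist z (g • z) ≤ 1 / 60) :
    g * P = P * g ∨ (tr g = 0 ∧ g * P * g⁻¹ = P⁻¹ ∧ 4 < tr P ^ 2) := by
  rcases le_or_gt 4 (tr P ^ 2) with h4 | h4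
  · have h2 : 2 ≤ tr P := by nlinarith
    have hc := commute_of_devAt hΓ hP (Γ.mul_mem (Γ.mul_mem hg hP) (Γ.inv_mem hg))
      (devAt_le_of_two_le_tr (z := z) h2 (by linarith))
      (devAt_le_of_two_le_tr (z := z) (by rwa [tr_conj]) (by
        linarith [dist_conj_le g P z]))
    rcases commute_or_inverted hΓ hP hg hn hc.symm with h | ⟨h, h', h''⟩
    · exact Or.inl h
    · exact Or.inr ⟨h', h, h''⟩
  · left
    set H := P * (g * P⁻¹ * g⁻¹) with hH
    have htH : 2 ≤ tr H := two_le_tr_commutator h4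
    have hHm : H ∈ Γ := Γ.mul_mem hP (Γ.mul_mem (Γ.mul_mem hg (Γ.inv_mem hP)) (Γ.inv_mem hg))
    have hdH : dist z (H • z) ≤ 4 / 60 := by
      have h1 := dist_smul_mul_le P (g * P⁻¹ * g⁻¹) z
      have h2 := dist_conj_le g P⁻¹ z
      rw [dist_smul_inv] at h2
      linarith
    by_cases hnH : NonTriv H
    · exfalso
      have hc := commute_of_devAt hΓ hHm (Γ.mul_mem (Γ.mul_mem hP hHm) (Γ.inv_mem hP))
        (devAt_le_of_two_le_tr (z := z) htH (by linarith))
        (devAt_le_of_two_le_tr (z := z) (by rwa [tr_conj]) (by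
          linarith [dist_conj_le P H z]))
      rcases commute_or_inverted hΓ hHm hP hnH hc.symm with h | ⟨-, h, -⟩
      · obtain ⟨t, ht0, hD⟩ := exists_discr_eq_of_commute hn hnH h
        have := sq_pos_of_ne_zero ht0
        nlinarith
      · exact ht.ne' h
    · unfold NonTriv at hnH
      rw [not_and_or, not_not, not_not] at hnH
      rcases hnH with h | h
      · have : P * g = (P * (g * P⁻¹ * g⁻¹)) * (g * P) := by group
        rw [this, ← hH, h, one_mul]
      · rw [h, tr_neg, tr_one] at htH
        norm_num at htH

/-- A Margulis lemma: the elements of a discrete group that move a point by a small amount commute,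
up to half-turns inverting a hyperbolic element. -/
lemma margulis {Γ : Subgroup SL(2, ℝ)} (hΓ : ActsDiscretely Γ) {P g : SL(2, ℝ)}
    {z : ℍ} (hP : P ∈ Γ) (hg : g ∈ Γ) (hn : NonTriv P) (ht : tr P ≠ 0)
    (hdP : dist z (P • z) ≤ 1 / 60) (hdg : dist z (g • z) ≤ 1 / 60) :
    g * P = P * g ∨ (tr g = 0 ∧ g * P * g⁻¹ = P⁻¹ ∧ 4 < tr P ^ 2) := by
  rcases lt_or_gt_of_ne ht with h | h
  · have := margulis_aux hΓ.withNegOne (P := -P) (g := g) (z := z) (Or.inr (by rwa [neg_neg]))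
      (Or.inl hg) hn.neg (by rw [tr_neg]; linarith) (by rwa [sl_neg_smul]) hdg
    simpa [tr_neg] using this
  · exact margulis_aux hΓ hP hg hn h hdP hdg

end MargulisLemma

/-! ### Conjugating the group. -/

section Conjugation

/-- The conjugate `u⁻¹ Γ u`. -/
def conjBy (u : SL(2, ℝ)) (Γ : Subgroup SL(2, ℝ)) : Subgroup SL(2, ℝ) :=
  Γ.comap (MulAut.conj u).toMonoidHom

lemma mem_conjBy {u g : SL(2, ℝ)} {Γ : Subgroup SL(2, ℝ)} :
    g ∈ conjBy u Γ ↔ u * g * u⁻¹ ∈ Γ := Iff.rfl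

lemma mem_conjBy' {u g : SL(2, ℝ)} {Γ : Subgroup SL(2, ℝ)} (h : g ∈ Γ) :
    u⁻¹ * g * u ∈ conjBy u Γ := by
  rw [mem_conjBy]
  convert h using 1
  group

lemma ActsDiscretely.conjBy {Γ : Subgroup SL(2, ℝ)} (h : ActsDiscretely Γ) (u : SL(2, ℝ)) :
    ActsDiscretely (conjBy u Γ) := by
  intro z R
  refine ((h (u • z) R).preimage (f := fun g => u * g * u⁻¹) ?_).subset ?_
  · intro a _ b _ hab
    simpa using hab
  · rintro g ⟨h1, h2⟩
    refine ⟨h1, ?_⟩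
    rwa [dist_conj_smul, inv_smul_smul]

lemma NonTriv.conj' {g : SL(2, ℝ)} (h : NonTriv g) (u : SL(2, ℝ)) : NonTriv (u⁻¹ * g * u) := by
  simpa using h.conj u⁻¹

lemma conj_smul_smul (u g : SL(2, ℝ)) (z : ℍ) : (u * g * u⁻¹) • (u • z) = u • (g • z) := by
  rw [mul_smul, mul_smul, inv_smul_smul]

lemma dist_conj_smul_smul (u g : SL(2, ℝ)) (z w : ℍ) :
    dist (u • w) ((u * g * u⁻¹) • (u • z)) = dist w (g • z) := by
  rw [conj_smul_smul, sl_dist_smul]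

end Conjugation

/-! ### The geodesic along the unit circle, orthogonal to the imaginary axis at `I`. -/

section Geodesic

/-- A unit speed geodesic through `I`. -/
noncomputable def geo (s : ℝ) : ℍ :=
  ⟨⟨Real.sinh s / Real.cosh s, 1 / Real.cosh s⟩, by
    have := Real.cosh_pos s
    simpa using this⟩

lemma geo_re (s : ℝ) : (geo s).re = Real.sinh s / Real.cosh s := rfl
lemma geo_im (s : ℝ) : (geo s).im = 1 / Real.cosh s := rfl

lemma geo_zero : geo 0 = UpperHalfPlane.I := by
  apply UpperHalfPlane.ext
  apply Complex.ext <;> simp [geo_re, geo_im]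

lemma dist_geo (s t : ℝ) : dist (geo s) (geo t) = |s - t| := by
  have h : Real.cosh (dist (geo s) (geo t)) = Real.cosh |s - t| := by
    rw [UpperHalfPlane.cosh_dist', Real.cosh_abs, Real.cosh_sub, geo_re, geo_re, geo_im, geo_im]
    have hs := Real.cosh_pos s
    have ht := Real.cosh_pos t
    have h1 := Real.cosh_sq s
    have h2 := Real.cosh_sq t
    field_simp
    linear_combination (-Real.cosh t ^ 2) * h1 - Real.cosh s ^ 2 * h2
  have h1 := Real.cosh_le_cosh.mp h.le
  have h2 := Real.cosh_le_cosh.mp h.ge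
  rw [abs_abs, abs_of_nonneg dist_nonneg] at h1 h2
  exact le_antisymm h1 h2

lemma dist_geo_I {s : ℝ} (hs : 0 ≤ s) : dist (geo s) UpperHalfPlane.I = s := by
  rw [← geo_zero, dist_geo, sub_zero, abs_of_nonneg hs]

lemma geo_re_sq_add (s : ℝ) : (geo s).re ^ 2 + (geo s).im ^ 2 = 1 := by
  rw [geo_re, geo_im]
  have := Real.cosh_pos s
  field_simp
  linear_combination -Real.cosh_sq s

lemma cosh_dist_I (z : ℍ) :
    Real.cosh (dist z UpperHalfPlane.I) = (z.re ^ 2 + z.im ^ 2 + 1) / (2 * z.im) := by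
  rw [UpperHalfPlane.cosh_dist']
  simp

lemma sinh_half_dist_rotation {g : SL(2, ℝ)} (h1 : g 0 0 = g 1 1) (h2 : g 0 1 = -g 1 0) (z : ℍ) :
    Real.sinh (dist z (g • z) / 2) ^ 2 =
      g 1 0 ^ 2 * Real.sinh (dist z UpperHalfPlane.I) ^ 2 := by
  have hy := z.im_pos
  rw [sinh_half_dist_smul_sq, Real.sinh_sq, cosh_dist_I, h1, h2]
  field_simp
  ring

lemma sinh_half_dist_diag {g : SL(2, ℝ)} (h1 : g 0 1 = 0) (h2 : g 1 0 = 0) (z : ℍ) :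
    Real.sinh (dist z (g • z) / 2) ^ 2 =
      (tr g ^ 2 - 4) / 4 * ((z.re ^ 2 + z.im ^ 2) / z.im ^ 2) := by
  have hy := z.im_pos
  have hd := sl_det g
  rw [h1] at hd
  rw [sinh_half_dist_smul_sq, h1, h2]
  unfold tr
  field_simp
  linear_combination (-4 * (z.re ^ 2 + z.im ^ 2)) * hd

end Geodesic

/-! ### Balls around cone points of order greater than 2. -/

section Cone

/-- The elements of `Γ` responsible for the thin region around the fixed point `p`: those fixing
`p`, and the hyperbolic elements inverted by a half-turn around `p`. -/
def ConeRel (Γ : Subgroup SL(2, ℝ)) (p : ℍ) (e : SL(2, ℝ)) : Prop :=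
  e • p = p ∨ ∃ α ∈ Γ, α • p = p ∧ tr α = 0 ∧ α * e * α⁻¹ = e⁻¹ ∧ 4 < tr e ^ 2

lemma ConeRel.conj {Γ : Subgroup SL(2, ℝ)} {u : SL(2, ℝ)} {p : ℍ} {e : SL(2, ℝ)}
    (h : ConeRel (conjBy u Γ) p e) : ConeRel Γ (u • p) (u * e * u⁻¹) := by
  rcases h with h | ⟨α, h1, h2, h3, h4, h5⟩
  · left; rw [conj_smul_smul, h]
  · right
    refine ⟨u * α * u⁻¹, h1, by rw [conj_smul_smul, h2], by rw [tr_conj, h3], ?_, by rwa [tr_conj]⟩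
    calc _ = u * (α * e * α⁻¹) * u⁻¹ := by group
      _ = _ := by rw [h4]; group

/-- The radius `r` defines a ball around `p` in the `ε`-thin part, and some point `w` on its
boundary is moved by at least `ε` by the group. -/
structure IsConeRadius (Γ : Subgroup SL(2, ℝ)) (ε : ℝ) (p : ℍ) (r : ℝ) : Prop where
  half_le : ε / 2 ≤ r
  thin : ∀ z : ℍ, dist z p < r → ∃ e ∈ Γ, NonTriv e ∧ dist z (e • z) ≤ ε ∧ ConeRel Γ p e
  thick : ∃ w w' : ℍ, dist w' w ≤ ε / 4 ∧ dist w' p ≤ r - ε / 4 ∧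
    ∀ γ ∈ Γ, NonTriv γ → ε ≤ dist w (γ • w)

lemma IsConeRadius.conj {Γ : Subgroup SL(2, ℝ)} {u : SL(2, ℝ)} {ε : ℝ} {p : ℍ} {r : ℝ}
    (h : IsConeRadius (conjBy u Γ) ε p r) : IsConeRadius Γ ε (u • p) r := by
  refine ⟨h.half_le, ?_, ?_⟩
  · intro z hz
    obtain ⟨e, h1, h2, h3, h4⟩ := h.thin (u⁻¹ • z) (by
      rwa [← sl_dist_smul u, smul_inv_smul])
    exact ⟨u * e * u⁻¹, h1, h2.conj u, by rwa [dist_conj_smul], h4.conj⟩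
  · obtain ⟨w, w', h1, h2, h3⟩ := h.thick
    refine ⟨u • w, u • w', by rwa [sl_dist_smul], by rwa [sl_dist_smul], ?_⟩
    intro γ hγ hn
    have := h3 _ (mem_conjBy' hγ) (hn.conj' u)
    rw [← dist_conj_smul_smul u] at this
    convert this using 3
    group

lemma isConeRadius_of_geo {Γ : Subgroup SL(2, ℝ)} {ε : ℝ} (hε : 0 < ε) {r : ℝ} (hr : ε / 2 ≤ r)
    (thin : ∀ z : ℍ, dist z UpperHalfPlane.I < r →
      ∃ e ∈ Γ, NonTriv e ∧ dist z (e • z) ≤ ε ∧ ConeRel Γ UpperHalfPlane.I e)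
    (thick : ∀ γ ∈ Γ, NonTriv γ → ε ≤ dist (geo r) (γ • geo r)) :
    IsConeRadius Γ ε UpperHalfPlane.I r := by
  refine ⟨hr, thin, geo r, geo (r - ε / 4), ?_, ?_, thick⟩
  · rw [dist_geo, show r - ε / 4 - r = -(ε / 4) by ring, abs_neg, abs_of_pos (by positivity)]
  · rw [dist_geo_I (by linarith)]

/-- A rotation `γ` about `I` moves a point at distance `r` by `d` with `sinh (d/2) = |γ 1 0| sinh
r`. The radius makes `d = ε` for the rotation `P` with least `|P 1 0|`. An element moving a boundary
point by less than ε would commute with `P`, hence be a rotation about `I` smaller than `P`. -/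
lemma exists_isConeRadius_of_tr_ne_zero {Γ : Subgroup SL(2, ℝ)} (hΓ : ActsDiscretely Γ) {ε : ℝ}
    (hε : 0 < ε) (hε' : ε ≤ 1 / 180)
    (h : ∃ g ∈ Γ, NonTriv g ∧ g • UpperHalfPlane.I = UpperHalfPlane.I ∧ tr g ≠ 0) :
    ∃ r, IsConeRadius Γ ε UpperHalfPlane.I r := by
  obtain ⟨g, hg, hgn, hgI, hgt⟩ := h
  have hfin : {γ : SL(2, ℝ) | γ ∈ Γ ∧ NonTriv γ ∧ γ • UpperHalfPlane.I = UpperHalfPlane.I}.Finite :=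
    (hΓ UpperHalfPlane.I 0).subset (by
      rintro γ ⟨h1, h2, h3⟩
      exact ⟨h1, by rw [h3, dist_self]⟩)
  obtain ⟨P, ⟨hP, hPn, hPI⟩, hmin⟩ := hfin.exists_minimalFor (fun γ => γ 1 0 ^ 2) _
    ⟨g, hg, hgn, hgI⟩
  have hmin' : ∀ γ ∈ Γ, NonTriv γ → γ • UpperHalfPlane.I = UpperHalfPlane.I →
      P 1 0 ^ 2 ≤ γ 1 0 ^ 2 := by
    intro γ h1 h2 h3
    rcases le_total (P 1 0 ^ 2) (γ 1 0 ^ 2) with h | h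
    · exact h
    · exact hmin ⟨h1, h2, h3⟩ h
  have hPe := smul_I_eq_iff.mp hPI
  have hge := smul_I_eq_iff.mp hgI
  have hc : P 1 0 ≠ 0 := fun h => nonTriv_iff.mp hPn ⟨by rw [hPe.2, h, neg_zero], h, hPe.1⟩
  have hc1 : P 1 0 ^ 2 < 1 := by
    refine (hmin' g hg hgn hgI).trans_lt ?_
    have hd := sl_det g
    rw [hge.1, hge.2] at hd
    have : g 1 1 ≠ 0 := by
      intro h0
      apply hgt
      unfold tr; rw [hge.1, h0, add_zero]
    have := sq_pos_of_ne_zero this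
    nlinarith
  have hPt : tr P ≠ 0 := by
    unfold tr
    rw [hPe.1]
    intro h0
    have hd := sl_det P
    have h1 : P 1 1 = 0 := by linarith
    rw [hPe.2, h1] at hd
    nlinarith
  have hca : 0 < |P 1 0| := abs_pos.mpr hc
  have hca1 : |P 1 0| < 1 := by
    rw [← sq_lt_one_iff_abs_lt_one]; exact hc1
  have hsε : 0 < Real.sinh (ε / 2) := Real.sinh_pos_iff.mpr (by positivity)
  obtain ⟨r, hr⟩ : ∃ r, Real.sinh r = Real.sinh (ε / 2) / |P 1 0| := ⟨_, Real.sinh_arsinh _⟩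
  have hr' : P 1 0 ^ 2 * Real.sinh r ^ 2 = Real.sinh (ε / 2) ^ 2 := by
    rw [hr, div_pow, sq_abs]; field_simp
  have hrε : ε / 2 ≤ r := by
    rw [← Real.sinh_le_sinh, hr, le_div_iff₀ hca]
    nlinarith
  have hr0 : 0 ≤ r := by linarith
  have hpow : ∀ γ : SL(2, ℝ), γ • UpperHalfPlane.I = UpperHalfPlane.I →
      Real.sinh (dist (geo r) (γ • geo r) / 2) ^ 2 = γ 1 0 ^ 2 * Real.sinh r ^ 2 := by
    intro γ h
    have h' := smul_I_eq_iff.mp h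
    rw [sinh_half_dist_rotation h'.1 h'.2, dist_geo_I hr0]
  refine ⟨r, isConeRadius_of_geo hε hrε ?_ ?_⟩
  · intro z hz
    refine ⟨P, hP, hPn, ?_, Or.inl hPI⟩
    rw [dist_le_iff_sinh_sq hε.le, sinh_half_dist_rotation hPe.1 hPe.2, ← hr']
    have : Real.sinh (dist z UpperHalfPlane.I) ≤ Real.sinh r := Real.sinh_le_sinh.mpr hz.le
    have h0 : 0 ≤ Real.sinh (dist z UpperHalfPlane.I) := Real.sinh_nonneg_iff.mpr dist_nonneg
    gcongr
  · intro γ hγ hγn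
    by_contra hlt
    push Not at hlt
    have hdP : dist (geo r) (P • geo r) ≤ ε := by
      rw [dist_le_iff_sinh_sq hε.le, hpow P hPI, hr']
    rcases margulis hΓ hP hγ hPn hPt (z := geo r) (by linarith) (by linarith) with h | ⟨-, -, h⟩
    · have hγI := smul_eq_iff_commute_of_fixed hPn hPI h.symm
      have h1 := hmin' γ hγ hγn hγI
      refine hlt.not_ge ?_
      rw [le_dist_iff_sinh_sq hε.le, hpow γ hγI, ← hr']
      gcongr
    · exact lt_asymm h (tr_sq_lt_of_fixed hPn hPI)

/-- The half-turn at `I` is `±J`, and conjugation by `J` is inverse transpose. -/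
lemma halfTurn_inverts_iff {α h : SL(2, ℝ)} (hα : α • UpperHalfPlane.I = UpperHalfPlane.I)
    (ht : tr α = 0) : α * h * α⁻¹ = h⁻¹ ↔ h 0 1 = h 1 0 := by
  obtain ⟨h1, h2⟩ := smul_I_eq_iff.mp hα
  have h3 : α 1 1 = 0 := by unfold tr at ht; linarith
  have hd := sl_det α
  rw [h1, h2, h3] at hd
  have hc : α 1 0 ^ 2 = 1 := by linarith
  rw [sl_ext_iff]
  simp only [sl_mul_apply, sl_inv_00, sl_inv_01, sl_inv_10, sl_inv_11, h1, h2, h3]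
  constructor
  · rintro ⟨-, h5, -, -⟩
    linear_combination h5 + h 1 0 * hc
  · intro h5
    refine ⟨?_, ?_, ?_, ?_⟩
    · linear_combination h 1 1 * hc
    · linear_combination -h 1 0 * hc + h5
    · linear_combination -h 0 1 * hc - h5
    · linear_combination h 0 0 * hc

lemma four_lt_tr_sq_of_symm {h : SL(2, ℝ)} (hn : NonTriv h) (hs : h 0 1 = h 1 0) :
    4 < tr h ^ 2 := by
  have hd := sl_det h
  rw [hs] at hd
  rw [nonTriv_iff] at hn
  by_contra hle
  push Not at hle
  unfold tr at hle
  have h1 : (h 0 0 - h 1 1) ^ 2 + 4 * h 1 0 ^ 2 ≤ 0 := by linarith [sq_nonneg (h 0 0 - h 1 1)]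
  have h2 : h 1 0 = 0 := by nlinarith [sq_nonneg (h 0 0 - h 1 1), sq_nonneg (h 1 0)]
  have h3 : h 0 0 - h 1 1 = 0 := by nlinarith [sq_nonneg (h 0 0 - h 1 1), sq_nonneg (h 1 0)]
  exact hn ⟨by rw [hs, h2], h2, by linarith⟩

end Cone

/-! ### Balls around cone points of order 2. -/

section HalfTurn

/-- The witness is the larger of `δ` and the solution of `L cosh r = s`, when the latter exists.
With `L = sinh (ℓ/2)`, the quantity `L cosh r` is `sinh` of half the displacement at distance `r`
from the axis of a translation of length `ℓ`. -/
lemma exists_radius {L s δ : ℝ} (hL : 0 < L) (hs : 0 < s) (hδ : 0 ≤ δ) :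
    ∃ r, δ ≤ r ∧ s ≤ L * Real.cosh r ∧ (r = δ ∨ L * Real.cosh r = s) := by
  rcases le_or_gt s (L * Real.cosh δ) with h | h
  · exact ⟨δ, le_rfl, h, Or.inl rfl⟩
  · have hK : Real.cosh δ < s / L := by rwa [lt_div_iff₀ hL, mul_comm]
    have hK1 : 1 ≤ s / L := (Real.one_le_cosh δ).trans hK.le
    obtain ⟨r, hr⟩ : ∃ r, Real.sinh r = Real.sqrt ((s / L) ^ 2 - 1) := ⟨_, Real.sinh_arsinh _⟩
    have hr0 : 0 ≤ r := by rw [← Real.sinh_nonneg_iff, hr]; positivity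
    have hc : Real.cosh r = s / L := by
      have h1 := Real.cosh_sq r
      rw [hr, Real.sq_sqrt (by nlinarith)] at h1
      have h2 := Real.cosh_pos r
      nlinarith
    have he : L * Real.cosh r = s := by rw [hc]; field_simp
    refine ⟨r, ?_, he.ge, Or.inr he⟩
    rw [← hc, Real.cosh_lt_cosh, abs_of_nonneg hδ, abs_of_nonneg hr0] at hK
    exact hK.le

/-- An antidiagonal half-turn is centred on the imaginary axis, and `I` is the point of that axis
nearest to a point of the unit circle. So it moves the point at least as far as the half-turn at `I`
does. -/
lemma antidiag_displacement {x y b c : ℝ} (hsum : x ^ 2 + y ^ 2 = 1) (hd : 0 * 0 - b * c = 1) :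
    x ^ 2 * (4 * y ^ 2) ≤
      ((c * (x ^ 2 - y ^ 2) + (0 - 0) * x - b) ^ 2 + (2 * c * x * y + (0 - 0) * y) ^ 2) * y ^ 2 := by
  have h1 : (c * (x ^ 2 - y ^ 2) + (0 - 0) * x - b) ^ 2 + (2 * c * x * y + (0 - 0) * y) ^ 2
      = (b + c) ^ 2 + 4 * x ^ 2 := by
    linear_combination (c ^ 2 * (x ^ 2 + y ^ 2 + 1) - 2) * hsum + 2 * (x ^ 2 - y ^ 2 + 1) * hd
  rw [h1]
  linarith [mul_nonneg (sq_nonneg (b + c)) (sq_nonneg y)]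

/-- The axis of `h` is the imaginary axis, and the boundary point is taken on the perpendicular at
`I`, where the distance to the axis is the full radius. An element moving it by less than ε either
commutes with `h`, so is diagonal and translates at least as far as `h` by minimality, or is a
half-turn centred on the axis and moves it by at least `2 r ≥ ε`. -/
lemma isConeRadius_of_diag {Γ : Subgroup SL(2, ℝ)} (hΓ : ActsDiscretely Γ) {ε : ℝ}
    (hε : 0 < ε) (hε' : ε ≤ 1 / 180) {α h : SL(2, ℝ)} (hα : α ∈ Γ) (hh : h ∈ Γ)
    (hαI : α • UpperHalfPlane.I = UpperHalfPlane.I) (hαt : tr α = 0) (hn : NonTriv h)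
    (h01 : h 0 1 = 0) (h10 : h 1 0 = 0)
    (hd : dist UpperHalfPlane.I (h • UpperHalfPlane.I) ≤ 2 * ε)
    (hmin : ∀ g ∈ Γ, NonTriv g → g 0 1 = g 1 0 →
      dist UpperHalfPlane.I (g • UpperHalfPlane.I) ≤ 2 * ε → tr h ^ 2 ≤ tr g ^ 2) :
    ∃ r, IsConeRadius Γ ε UpperHalfPlane.I r := by
  have hinv : α * h * α⁻¹ = h⁻¹ := (halfTurn_inverts_iff hαI hαt).mpr (by rw [h01, h10])
  have ht4 : 4 < tr h ^ 2 := four_lt_tr_sq_of_symm hn (by rw [h01, h10])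
  have hαn : NonTriv α := nonTriv_of_tr (by rw [hαt]; norm_num)
  obtain ⟨hα1, hα2⟩ := smul_I_eq_iff.mp hαI
  set L := Real.sqrt ((tr h ^ 2 - 4) / 4) with hL
  have hLsq : L ^ 2 = (tr h ^ 2 - 4) / 4 := Real.sq_sqrt (by linarith)
  have hLpos : 0 < L := Real.sqrt_pos.mpr (by linarith)
  have hsε : 0 < Real.sinh (ε / 2) := Real.sinh_pos_iff.mpr (by positivity)
  obtain ⟨r, hr1, hr2, hr3⟩ := exists_radius hLpos hsε (δ := ε / 2) (by positivity)
  have hr0 : 0 ≤ r := by linarith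
  have hcr := Real.cosh_pos r
  have hgeo : ((geo r).re ^ 2 + (geo r).im ^ 2) / (geo r).im ^ 2 = Real.cosh r ^ 2 := by
    rw [geo_re_sq_add, geo_im]; field_simp
  refine ⟨r, isConeRadius_of_geo hε hr1 ?_ ?_⟩
  · intro z hz
    rcases hr3 with hr3 | hr3
    · refine ⟨α, hα, hαn, ?_, Or.inl hαI⟩
      have := dist_smul_le_of_dist α z UpperHalfPlane.I
      rw [hαI, dist_self] at this
      linarith
    · refine ⟨h, hh, hn, ?_, Or.inr ⟨α, hα, hαI, hαt, hinv, ht4⟩⟩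
      rw [dist_le_iff_sinh_sq hε.le, sinh_half_dist_diag h01 h10, ← hr3, ← hLsq, mul_pow]
      have h1 : Real.cosh (dist z UpperHalfPlane.I) ≤ Real.cosh r := by
        rw [Real.cosh_le_cosh, abs_of_nonneg dist_nonneg, abs_of_nonneg hr0]; exact hz.le
      have h2 : (z.re ^ 2 + z.im ^ 2) / z.im ^ 2 ≤ Real.cosh (dist z UpperHalfPlane.I) ^ 2 := by
        rw [cosh_dist_I, div_pow, div_le_div_iff₀ (by positivity) (by positivity)]
        have hy : 0 ≤ z.im ^ 2 := by positivity
        have : (z.re ^ 2 + z.im ^ 2) * 4 ≤ (z.re ^ 2 + z.im ^ 2 + 1) ^ 2 := by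
          nlinarith [sq_nonneg (z.re ^ 2 + z.im ^ 2 - 1)]
        nlinarith
      have h3 : Real.cosh (dist z UpperHalfPlane.I) ^ 2 ≤ Real.cosh r ^ 2 :=
        pow_le_pow_left₀ (Real.cosh_pos _).le h1 2
      exact mul_le_mul_of_nonneg_left (h2.trans h3) (by positivity)
  · intro γ hγ hγn
    by_contra hlt
    push Not at hlt
    -- When `r = ε/2`, the bound is `2 r + 2 ε = 3 ε`. This is what requires `ε ≤ 1/180`, a third of
    -- the Margulis constant.
    have hw : dist (geo r) (h • geo r) ≤ 3 * ε := by
      rcases hr3 with hr3 | hr3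
      · have := dist_smul_le_of_dist h (geo r) UpperHalfPlane.I
        rw [dist_geo_I hr0, hr3] at this
        rw [hr3]
        linarith
      · have : dist (geo r) (h • geo r) ≤ ε := by
          rw [dist_le_iff_sinh_sq hε.le, sinh_half_dist_diag h01 h10, hgeo, ← hr3, mul_pow, hLsq]
        linarith
    have ht0 : tr h ≠ 0 := by
      intro h0; rw [h0] at ht4; norm_num at ht4
    apply hlt.not_ge
    rw [le_dist_iff_sinh_sq hε.le]
    rcases margulis hΓ hh hγ hn ht0 (z := geo r) (by linarith) (by linarith) with hc | ⟨hγt, hc, -⟩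
    · obtain ⟨s, t, e1, e2, e3, e4⟩ := exists_eq_of_commute hn hc.symm
      rw [h01, mul_zero] at e2
      rw [h10, mul_zero] at e3
      have htr : tr h ^ 2 ≤ tr γ ^ 2 := by
        rcases le_or_gt (dist UpperHalfPlane.I (γ • UpperHalfPlane.I)) (2 * ε) with hle | hgt
        · exact hmin γ hγ hγn (by rw [e2, e3]) hle
        · have h1 : Real.cosh (dist UpperHalfPlane.I (h • UpperHalfPlane.I)) ≤
              Real.cosh (dist UpperHalfPlane.I (γ • UpperHalfPlane.I)) := by
            rw [Real.cosh_le_cosh, abs_of_nonneg dist_nonneg, abs_of_nonneg dist_nonneg]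
            linarith
          have h2 := cosh_dist_I_smul h
          have h3 := cosh_dist_I_smul γ
          have h4 := sl_det h
          have h5 := sl_det γ
          rw [h01, h10] at h2 h4
          rw [e2, e3] at h3 h5
          unfold tr
          nlinarith
      rw [sinh_half_dist_diag e2 e3, hgeo]
      calc Real.sinh (ε / 2) ^ 2 ≤ (L * Real.cosh r) ^ 2 := pow_le_pow_left₀ hsε.le hr2 2
        _ = (tr h ^ 2 - 4) / 4 * Real.cosh r ^ 2 := by rw [mul_pow, hLsq]
        _ ≤ _ := by gcongr
    · have k : γ * h = h⁻¹ * γ := by rw [← hc]; group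
      have hdh := sl_det h
      have hdγ := sl_det γ
      rw [sl_ext_iff] at k
      simp only [sl_mul_apply, sl_inv_00, sl_inv_01, sl_inv_10, sl_inv_11, h01, h10] at k
      obtain ⟨k1, -, -, k4⟩ := k
      have hne : h 0 0 - h 1 1 ≠ 0 := fun h0 => nonTriv_iff.mp hn ⟨h01, h10, by linarith⟩
      have e1 : γ 0 0 = 0 := by
        have : γ 0 0 * (h 0 0 - h 1 1) = 0 := by linarith
        exact (mul_eq_zero.mp this).resolve_right hne
      have e4 : γ 1 1 = 0 := by
        have : γ 1 1 * (h 0 0 - h 1 1) = 0 := by linarith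
        exact (mul_eq_zero.mp this).resolve_right hne
      rw [e1, e4] at hdγ
      have hyp := (geo r).im_pos
      have hsum := geo_re_sq_add r
      have hsr : Real.sinh r ^ 2 = (geo r).re ^ 2 / (geo r).im ^ 2 := by
        rw [geo_re, geo_im]; field_simp
      calc Real.sinh (ε / 2) ^ 2 ≤ Real.sinh r ^ 2 :=
            pow_le_pow_left₀ hsε.le (Real.sinh_le_sinh.mpr hr1) 2
        _ ≤ _ := by
          rw [hsr, sinh_half_dist_smul_sq, e1, e4, div_le_div_iff₀ (by positivity) (by positivity)]
          exact antidiag_displacement hsum hdγ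

/-- Symmetric matrices are diagonalised by rotations. -/
lemma exists_rotation_diag {h : SL(2, ℝ)} (hs : h 0 1 = h 1 0) :
    ∃ k : SL(2, ℝ), k • UpperHalfPlane.I = UpperHalfPlane.I ∧ (k⁻¹ * h * k) 0 1 = 0 ∧
      (k⁻¹ * h * k) 1 0 = 0 := by
  -- The angle of the principal axes of a symmetric matrix is half the argument of `ζ`.
  set ζ : ℂ := ⟨(h 0 0 - h 1 1) / 2, h 1 0⟩ with hζ
  set θ := Complex.arg ζ / 2 with hθ
  have h1 := Complex.norm_mul_cos_arg ζ
  have h2 := Complex.norm_mul_sin_arg ζ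
  rw [show Complex.arg ζ = 2 * θ by rw [hθ]; ring] at h1 h2
  rw [Real.cos_two_mul'] at h1
  rw [Real.sin_two_mul] at h2
  have hre : ζ.re = (h 0 0 - h 1 1) / 2 := rfl
  have him : ζ.im = h 1 0 := rfl
  rw [hre] at h1
  rw [him] at h2
  have hcs := Real.sin_sq_add_cos_sq θ
  let k : SL(2, ℝ) := ⟨!![Real.cos θ, -Real.sin θ; Real.sin θ, Real.cos θ], by
    rw [Matrix.det_fin_two_of]; linarith⟩
  have k00 : k 0 0 = Real.cos θ := rfl
  have k01 : k 0 1 = -Real.sin θ := rfl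
  have k10 : k 1 0 = Real.sin θ := rfl
  have k11 : k 1 1 = Real.cos θ := rfl
  refine ⟨k, ?_, ?_, ?_⟩
  · rw [smul_I_eq_iff, k00, k01, k10, k11]; simp
  · simp only [sl_mul_apply, sl_inv_00, sl_inv_01, k01, k11, hs]
    linear_combination (-(Real.cos θ ^ 2 - Real.sin θ ^ 2)) * h2 +
      (2 * Real.sin θ * Real.cos θ) * h1
  · simp only [sl_mul_apply, sl_inv_10, sl_inv_11, k00, k10, hs]
    linear_combination (-(Real.cos θ ^ 2 - Real.sin θ ^ 2)) * h2 +
      (2 * Real.sin θ * Real.cos θ) * h1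

/-- `E` is the set of short elements inverted by the half-turn at `I`. If it is nonempty, its member
of least trace is diagonalised by a rotation. If it is empty, radius ε/2 works: an element `γ`
moving the boundary point by less than ε either is itself inverted by `α`, or is a half-turn
elsewhere and `α γ` is inverted; both would lie in `E`. -/
lemma exists_isConeRadius_of_tr_eq_zero {Γ : Subgroup SL(2, ℝ)} (hΓ : ActsDiscretely Γ) {ε : ℝ}
    (hε : 0 < ε) (hε' : ε ≤ 1 / 180)
    (h : ∀ g ∈ Γ, NonTriv g → g • UpperHalfPlane.I = UpperHalfPlane.I → tr g = 0)
    (hex : ∃ g ∈ Γ, NonTriv g ∧ g • UpperHalfPlane.I = UpperHalfPlane.I) :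
    ∃ r, IsConeRadius Γ ε UpperHalfPlane.I r := by
  obtain ⟨α, hα, hαn, hαI⟩ := hex
  have hαt := h α hα hαn hαI
  have hαe := smul_I_eq_iff.mp hαI
  set E := {g : SL(2, ℝ) | g ∈ Γ ∧ NonTriv g ∧ g 0 1 = g 1 0 ∧
    dist UpperHalfPlane.I (g • UpperHalfPlane.I) ≤ 2 * ε} with hE
  have hfin : E.Finite := (hΓ UpperHalfPlane.I (2 * ε)).subset fun g hg => ⟨hg.1, hg.2.2.2⟩
  rcases E.eq_empty_or_nonempty with hemp | hne
  · have hE' : ∀ g ∈ Γ, NonTriv g → g 0 1 = g 1 0 →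
        dist UpperHalfPlane.I (g • UpperHalfPlane.I) ≤ 2 * ε → False := by
      intro g h1 h2 h3 h4
      have : g ∈ E := ⟨h1, h2, h3, h4⟩
      rw [hemp] at this
      exact this
    have hε2 : 0 ≤ ε / 2 := by positivity
    have hα10 : α 1 0 ^ 2 = 1 := by
      have hd := sl_det α
      have : α 1 1 = 0 := by unfold tr at hαt; linarith [hαe.1]
      rw [hαe.2, this] at hd
      linarith
    refine ⟨ε / 2, isConeRadius_of_geo hε le_rfl ?_ ?_⟩
    · intro z hz
      refine ⟨α, hα, hαn, ?_, Or.inl hαI⟩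
      have := dist_smul_le_of_dist α z UpperHalfPlane.I
      rw [hαI, dist_self] at this
      linarith
    · intro γ hγ hγn
      by_contra hlt
      push Not at hlt
      have hαw : dist (geo (ε / 2)) (α • geo (ε / 2)) ≤ ε := by
        have := dist_smul_le_of_dist α (geo (ε / 2)) UpperHalfPlane.I
        rw [hαI, dist_self, dist_geo_I hε2] at this
        linarith
      have hγI : dist UpperHalfPlane.I (γ • UpperHalfPlane.I) ≤ 2 * ε := by
        have := dist_smul_le_of_dist γ UpperHalfPlane.I (geo (ε / 2))
        rw [dist_comm _ (geo _), dist_geo_I hε2] at this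
        linarith
      by_cases hγt : tr γ = 0
      · have hsym : (α * γ) 0 1 = (α * γ) 1 0 := by
          have h1 : α 1 1 = 0 := by unfold tr at hαt; linarith [hαe.1]
          have h2 : γ 1 1 = -γ 0 0 := by unfold tr at hγt; linarith
          rw [sl_mul_apply, sl_mul_apply, hαe.1, hαe.2, h1, h2]; ring
        refine hE' (α * γ) (Γ.mul_mem hα hγ) ?_ hsym ?_
        · have key : γ • UpperHalfPlane.I = UpperHalfPlane.I → False := by
            intro hγf
            have hγe := smul_I_eq_iff.mp hγf
            have hγ10 : γ 1 0 ^ 2 = 1 := by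
              have hd := sl_det γ
              have : γ 1 1 = 0 := by unfold tr at hγt; linarith [hγe.1]
              rw [hγe.2, this] at hd
              linarith
            apply hlt.not_ge
            rw [le_dist_iff_sinh_sq hε.le, sinh_half_dist_rotation hγe.1 hγe.2, hγ10,
              dist_geo_I hε2, one_mul]
          constructor
          · intro h1
            have : γ = α⁻¹ := eq_inv_of_mul_eq_one_right h1
            exact key (by rw [this, inv_smul_eq_iff, hαI])
          · intro h1
            have : γ = -α⁻¹ := by
              rw [← inv_mul_cancel_left α γ, h1]; simp
            exact key (by rw [this, sl_neg_smul, inv_smul_eq_iff, hαI])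
        · have := dist_smul_mul_le α γ UpperHalfPlane.I
          rw [hαI, dist_self] at this
          linarith
      · rcases margulis hΓ hγ hα hγn hγt (z := geo (ε / 2)) (by linarith) (by linarith) with
          hc | ⟨-, hc, -⟩
        · exact hγt (h γ hγ hγn (smul_eq_iff_commute_of_fixed hαn hαI hc))
        · exact hE' γ hγ hγn ((halfTurn_inverts_iff hαI hαt).mp hc) hγI
  · obtain ⟨g, ⟨hg, hgn, hgs, hgd⟩, hmin⟩ := hfin.exists_minimalFor (fun γ => tr γ ^ 2) _ hne
    have hmin' : ∀ γ ∈ E, tr g ^ 2 ≤ tr γ ^ 2 := by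
      intro γ h1
      rcases le_total (tr g ^ 2) (tr γ ^ 2) with h | h
      · exact h
      · exact hmin h1 h
    obtain ⟨k, hkI, hk1, hk2⟩ := exists_rotation_diag hgs
    have hkI' : k⁻¹ • UpperHalfPlane.I = UpperHalfPlane.I := by rw [inv_smul_eq_iff, hkI]
    have htc : ∀ x, tr (k⁻¹ * x * k) = tr x := fun x => by simpa using tr_conj k⁻¹ x
    have hαk : (k⁻¹ * α * k) • UpperHalfPlane.I = UpperHalfPlane.I := by
      rw [mul_smul, mul_smul, hkI, hαI, hkI']
    have hdk : ∀ x : SL(2, ℝ), dist UpperHalfPlane.I ((k * x * k⁻¹) • UpperHalfPlane.I) =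
        dist UpperHalfPlane.I (x • UpperHalfPlane.I) := by
      intro x
      rw [dist_conj_smul, hkI']
    obtain ⟨r, hr⟩ := isConeRadius_of_diag (hΓ.conjBy k) hε hε' (mem_conjBy' hα) (mem_conjBy' hg)
      hαk (by rw [htc, hαt]) (hgn.conj' k) hk1 hk2
      (by
        rw [← hdk]
        convert hgd using 3
        group)
      (by
        intro x hx hxn hxs hxd
        rw [htc, ← tr_conj k x]
        refine hmin' _ ⟨hx, hxn.conj k, ?_, by rwa [hdk]⟩
        have hinv := (halfTurn_inverts_iff hαk (by rw [htc, hαt])).mpr hxs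
        rw [← halfTurn_inverts_iff hαI hαt]
        calc α * (k * x * k⁻¹) * α⁻¹
            = k * ((k⁻¹ * α * k) * x * (k⁻¹ * α * k)⁻¹) * k⁻¹ := by group
          _ = _ := by rw [hinv]; group)
    have := hr.conj
    rw [hkI] at this
    exact ⟨r, this⟩

lemma exists_isConeRadius {Γ : Subgroup SL(2, ℝ)} (hΓ : ActsDiscretely Γ) {ε : ℝ}
    (hε : 0 < ε) (hε' : ε ≤ 1 / 180) {p : ℍ} (hp : ∃ g ∈ Γ, NonTriv g ∧ g • p = p) :
    ∃ r, IsConeRadius Γ ε p r := by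
  obtain ⟨u, rfl⟩ : ∃ u : SL(2, ℝ), u • UpperHalfPlane.I = p :=
    ⟨p.toSL2R, UpperHalfPlane.toSL2R_smul_I p⟩
  obtain ⟨g, hg, hn, hgp⟩ := hp
  have hex : ∃ g ∈ conjBy u Γ, NonTriv g ∧ g • UpperHalfPlane.I = UpperHalfPlane.I :=
    ⟨u⁻¹ * g * u, mem_conjBy' hg, hn.conj' u, by rw [mul_smul, mul_smul, hgp, inv_smul_smul]⟩
  obtain ⟨r, hr⟩ : ∃ r, IsConeRadius (conjBy u Γ) ε UpperHalfPlane.I r := by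
    by_cases h : ∀ g ∈ conjBy u Γ, NonTriv g → g • UpperHalfPlane.I = UpperHalfPlane.I → tr g = 0
    · exact exists_isConeRadius_of_tr_eq_zero (hΓ.conjBy u) hε hε' h hex
    · push Not at h
      exact exists_isConeRadius_of_tr_ne_zero (hΓ.conjBy u) hε hε' h
  exact ⟨r, hr.conj⟩

end HalfTurn

/-! ### Horoballs at cusps. -/

section CuspHoroball

local notation "gl" => Matrix.SpecialLinearGroup.mapGL (n := Fin 2) (R := ℝ) ℝ

lemma mapGL_apply (g : SL(2, ℝ)) (i j : Fin 2) : (gl g) i j = g i j := rfl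

/-- Parabolic elements of `SL(2, ℝ)`. -/
def Parab (g : SL(2, ℝ)) : Prop := NonTriv g ∧ tr g ^ 2 = 4

lemma parab_iff {g : SL(2, ℝ)} : (gl g).IsParabolic ↔ Parab g := by
  have hdet := sl_det g
  have h1 : (gl g).val.discr = tr g ^ 2 - 4 := by
    rw [Matrix.discr_fin_two, Matrix.trace_fin_two, Matrix.det_fin_two]
    change (g 0 0 + g 1 1) ^ 2 - 4 * (g 0 0 * g 1 1 - g 0 1 * g 1 0) = _
    rw [hdet]; unfold tr; ring
  have h2 : (gl g).val ∈ Set.range (Matrix.scalar (Fin 2)) ↔ ¬ NonTriv g := by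
    rw [nonTriv_iff, not_not]
    constructor
    · rintro ⟨a, ha⟩
      have e : ∀ i j, g i j = Matrix.scalar (Fin 2) a i j := fun i j => by rw [ha]; rfl
      rw [e, e, e, e]; simp
    · rintro ⟨h1, h2, h3⟩
      refine ⟨g 1 1, ?_⟩
      ext i j
      change _ = g i j
      fin_cases i <;> fin_cases j <;> simp [h1, h2, h3]
  unfold Parab Matrix.GeneralLinearGroup.IsParabolic Matrix.IsParabolic
  rw [h1, h2, not_not, sub_eq_zero]

lemma Parab.conj' {g : SL(2, ℝ)} (h : Parab g) (u : SL(2, ℝ)) : Parab (u⁻¹ * g * u) :=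
  ⟨h.1.conj' u, by
    have := tr_conj u⁻¹ g
    rw [inv_inv] at this
    rw [this, h.2]⟩

lemma Parab.conj {g : SL(2, ℝ)} (h : Parab g) (u : SL(2, ℝ)) : Parab (u * g * u⁻¹) :=
  ⟨h.1.conj u, by rw [tr_conj, h.2]⟩

lemma isCusp_iff_parab {Γ : Subgroup SL(2, ℝ)} {c : OnePoint ℝ} :
    IsCusp c (toGL Γ) ↔ ∃ P ∈ Γ, Parab P ∧ gl P • c = c := by
  constructor
  · rintro ⟨_, ⟨P, hP, rfl⟩, h1, h2⟩
    exact ⟨P, hP, parab_iff.mp h1, h2⟩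
  · rintro ⟨P, hP, h1, h2⟩
    exact ⟨gl P, ⟨P, hP, rfl⟩, parab_iff.mpr h1, h2⟩

/-- `H` is a horoball at `c` in the `ε`-thin part, and some point `w` on its boundary is moved by
at least `ε` by the group. -/
structure IsThinHoroball (Γ : Subgroup SL(2, ℝ)) (ε : ℝ) (c : OnePoint ℝ) (H : Set ℍ) : Prop where
  horoball : IsHoroballAt c H
  thin : ∀ z ∈ H, ∃ e ∈ Γ, Parab e ∧ gl e • c = c ∧ dist z (e • z) ≤ ε
  thick : ∃ w w' : ℍ, dist w' w ≤ ε / 4 ∧ Metric.ball w' (ε / 4) ⊆ H ∧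
    ∀ γ ∈ Γ, NonTriv γ → ε ≤ dist w (γ • w)

lemma IsThinHoroball.conj {Γ : Subgroup SL(2, ℝ)} {u : SL(2, ℝ)} {ε : ℝ} {c : OnePoint ℝ}
    {H : Set ℍ} (h : IsThinHoroball (conjBy u Γ) ε c H) :
    IsThinHoroball Γ ε (gl u • c) ((fun z => u • z) '' H) := by
  refine ⟨?_, ?_, ?_⟩
  · obtain ⟨g, h1, h2⟩ := h.horoball
    refine ⟨u * g, by rw [map_mul, mul_smul, h1], ?_⟩
    rw [h2, Set.image_image]
    simp only [mul_smul]
  · rintro _ ⟨z, hz, rfl⟩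
    obtain ⟨e, h1, h2, h3, h4⟩ := h.thin z hz
    refine ⟨u * e * u⁻¹, h1, h2.conj u, ?_, ?_⟩
    · rw [map_mul, map_mul, map_inv, mul_smul, mul_smul, inv_smul_smul, h3]
    · simp only
      rwa [dist_conj_smul_smul]
  · obtain ⟨w, w', h1, h2, h3⟩ := h.thick
    refine ⟨u • w, u • w', by rwa [sl_dist_smul], ?_, ?_⟩
    · intro z hz
      refine ⟨u⁻¹ • z, h2 ?_, smul_inv_smul u z⟩
      rw [Metric.mem_ball] at hz ⊢
      rwa [← sl_dist_smul u, smul_inv_smul]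
    · intro γ hγ hn
      have := h3 _ (mem_conjBy' hγ) (hn.conj' u)
      rw [← dist_conj_smul_smul u] at this
      convert this using 3
      group

lemma sinh_half_dist_unipotent {g : SL(2, ℝ)} (h1 : g 1 0 = 0) (h2 : g 0 0 = g 1 1) (z : ℍ) :
    Real.sinh (dist z (g • z) / 2) ^ 2 = g 0 1 ^ 2 / (4 * z.im ^ 2) := by
  rw [sinh_half_dist_smul_sq, h1, h2]
  congr 1
  ring

lemma isHoroballAt_infty {t : ℝ} (ht : 0 < t) :
    IsHoroballAt OnePoint.infty {z : ℍ | t < z.im} := by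
  have hs := Real.sqrt_pos.mpr ht
  let g : SL(2, ℝ) := ⟨!![Real.sqrt t, 0; 0, (Real.sqrt t)⁻¹], by
    rw [Matrix.det_fin_two_of, mul_inv_cancel₀ hs.ne']; ring⟩
  have g10 : g 1 0 = 0 := rfl
  have g11 : g 1 1 = (Real.sqrt t)⁻¹ := rfl
  have him : ∀ z : ℍ, (g • z).im = t * z.im := by
    intro z
    rw [sl_im_smul, g10, g11]
    simp only [Complex.ofReal_zero, zero_mul, zero_add, Complex.normSq_ofReal]
    rw [← mul_inv, Real.mul_self_sqrt ht.le]
    field_simp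
  refine ⟨g, ?_, ?_⟩
  · rw [OnePoint.smul_infty_eq_self_iff]; exact g10
  · ext z
    constructor
    · intro hz
      refine ⟨g⁻¹ • z, ?_, smul_inv_smul g z⟩
      have h1 := him (g⁻¹ • z)
      rw [smul_inv_smul] at h1
      have hz' : t < z.im := hz
      rw [h1] at hz'
      change 1 < (g⁻¹ • z).im
      by_contra hle
      push Not at hle
      nlinarith
    · rintro ⟨y, hy, rfl⟩
      change t < (g • y).im
      rw [him]
      have : 1 < y.im := hy
      nlinarith

/-- The height `t` is the one at which the shortest translation `P` moves points by exactly ε. An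
element moving a point at this height by less than ε commutes with `P`, hence is a translation no
shorter than `P`. -/
lemma exists_isThinHoroball_infty {Γ : Subgroup SL(2, ℝ)} (hΓ : ActsDiscretely Γ) {ε : ℝ}
    (hε : 0 < ε) (hε' : ε ≤ 1 / 180)
    (hc : ∃ P ∈ Γ, Parab P ∧ gl P • (OnePoint.infty : OnePoint ℝ) = OnePoint.infty) :
    ∃ H, IsThinHoroball Γ ε OnePoint.infty H := by
  obtain ⟨Q, hQ, hQp, hQc⟩ := hc
  have hshape : ∀ g : SL(2, ℝ), tr g ^ 2 = 4 → g 1 0 = 0 → g 0 0 = g 1 1 := by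
    intro g h1 h2
    have hd := sl_det g
    rw [h2] at hd
    unfold tr at h1
    have : (g 0 0 - g 1 1) ^ 2 = 0 := by linarith
    linarith [pow_eq_zero_iff (two_ne_zero) |>.mp this]
  rw [OnePoint.smul_infty_eq_self_iff, mapGL_apply] at hQc
  have hQe := hshape Q hQp.2 hQc
  set E := {g : SL(2, ℝ) | g ∈ Γ ∧ NonTriv g ∧ g 1 0 = 0 ∧ g 0 0 = g 1 1 ∧ g 0 1 ^ 2 ≤ Q 0 1 ^ 2}
  have hfin : E.Finite := by
    refine (hΓ UpperHalfPlane.I (2 + Q 0 1 ^ 2)).subset ?_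
    rintro g ⟨h1, -, h3, h4, h5⟩
    refine ⟨h1, (dist_le_two_mul_cosh _ _).trans ?_⟩
    have hd := sl_det g
    rw [h3, h4] at hd
    rw [cosh_dist_I_smul, h3, h4]
    linarith
  obtain ⟨P, ⟨hP, hPn, hP10, hPe, hPQ⟩, hmin⟩ := hfin.exists_minimalFor (fun g => g 0 1 ^ 2) _
    ⟨Q, hQ, hQp.1, hQc, hQe, le_rfl⟩
  have hmin' : ∀ g ∈ Γ, NonTriv g → g 1 0 = 0 → g 0 0 = g 1 1 → P 0 1 ^ 2 ≤ g 0 1 ^ 2 := by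
    intro g h1 h2 h3 h4
    rcases le_total (P 0 1 ^ 2) (g 0 1 ^ 2) with h | h
    · exact h
    · exact hmin ⟨h1, h2, h3, h4, h.trans hPQ⟩ h
  have hb : P 0 1 ≠ 0 := fun h => nonTriv_iff.mp hPn ⟨h, hP10, hPe⟩
  have hPt : tr P ^ 2 = 4 := by
    have hd := sl_det P
    rw [hP10, hPe] at hd
    unfold tr
    rw [hPe]
    linarith
  have hsε : 0 < Real.sinh (ε / 2) := Real.sinh_pos_iff.mpr (by positivity)
  have hba : 0 < |P 0 1| := abs_pos.mpr hb
  set t := |P 0 1| / (2 * Real.sinh (ε / 2)) with ht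
  have htpos : 0 < t := by positivity
  have htsq : P 0 1 ^ 2 / (4 * t ^ 2) = Real.sinh (ε / 2) ^ 2 := by
    rw [ht, div_pow, sq_abs]
    field_simp
    norm_num
  refine ⟨{z : ℍ | t < z.im}, isHoroballAt_infty htpos, ?_, ?_⟩
  · intro z hz
    have hz : t < z.im := hz
    refine ⟨P, hP, ⟨hPn, hPt⟩, ?_, ?_⟩
    · rw [OnePoint.smul_infty_eq_self_iff, mapGL_apply, hP10]
    · rw [dist_le_iff_sinh_sq hε.le, sinh_half_dist_unipotent hP10 hPe, ← htsq]
      gcongr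
  · let w : ℍ := ⟨⟨0, t⟩, htpos⟩
    let w' : ℍ := ⟨⟨0, t * Real.exp (ε / 4)⟩, mul_pos htpos (Real.exp_pos _)⟩
    have hw : w.im = t := rfl
    have hw' : w'.im = t * Real.exp (ε / 4) := rfl
    refine ⟨w, w', ?_, ?_, ?_⟩
    · rw [UpperHalfPlane.dist_of_re_eq (show w'.re = w.re from rfl), hw, hw',
        Real.log_mul htpos.ne' (Real.exp_pos _).ne', Real.log_exp, Real.dist_eq,
        add_sub_cancel_left, abs_of_pos (by positivity)]
    · intro z hz
      rw [Metric.mem_ball, dist_comm] at hz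
      have h1 := UpperHalfPlane.im_div_exp_dist_le w' z
      rw [hw', div_le_iff₀ (Real.exp_pos _)] at h1
      have h2 := Real.exp_lt_exp.mpr hz
      have h3 := z.im_pos
      change t < z.im
      by_contra hle
      push Not at hle
      have h4 := Real.exp_pos (ε / 4)
      nlinarith
    · intro γ hγ hγn
      by_contra hlt
      push Not at hlt
      have hdP : dist w (P • w) ≤ ε := by
        rw [dist_le_iff_sinh_sq hε.le, sinh_half_dist_unipotent hP10 hPe, hw, htsq]
      have ht0 : tr P ≠ 0 := by
        intro h0; rw [h0] at hPt; norm_num at hPt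
      rcases margulis hΓ hP hγ hPn ht0 (z := w) (by linarith) (by linarith) with h | ⟨-, -, h⟩
      · obtain ⟨s, r, e1, e2, e3, e4⟩ := exists_eq_of_commute hPn h.symm
        have h10 : γ 1 0 = 0 := by rw [e3, hP10, mul_zero]
        have he : γ 0 0 = γ 1 1 := by rw [e1, e4, hPe]
        refine hlt.not_ge ?_
        rw [le_dist_iff_sinh_sq hε.le, sinh_half_dist_unipotent h10 he, hw, ← htsq]
        have := hmin' γ hγ hγn h10 he
        gcongr
      · rw [hPt] at h
        exact lt_irrefl _ h

lemma exists_isThinHoroball {Γ : Subgroup SL(2, ℝ)} (hΓ : ActsDiscretely Γ) {ε : ℝ}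
    (hε : 0 < ε) (hε' : ε ≤ 1 / 180) {c : OnePoint ℝ} (hc : IsCusp c (toGL Γ)) :
    ∃ H, IsThinHoroball Γ ε c H := by
  obtain ⟨u, rfl⟩ := OnePoint.exists_mem_SL2 ℝ c
  obtain ⟨P, hP, hPp, hPc⟩ := isCusp_iff_parab.mp hc
  obtain ⟨H, hH⟩ := exists_isThinHoroball_infty (hΓ.conjBy u) hε hε'
    ⟨u⁻¹ * P * u, mem_conjBy' hP, hPp.conj' u, by
      rw [map_mul, map_mul, map_inv, mul_smul, mul_smul, hPc, inv_smul_smul]⟩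
  exact ⟨_, hH.conj⟩

end CuspHoroball

/-! ### Half-turns along a common axis. -/

section HalfTurnOrbits

/-- Logarithms of the translation factors of the diagonal elements of `Γ`. -/
noncomputable def diagLogs (Γ : Subgroup SL(2, ℝ)) : AddSubgroup ℝ where
  carrier := {x | ∃ g ∈ Γ, g 0 1 = 0 ∧ g 1 0 = 0 ∧ |g 0 0| = Real.exp x}
  zero_mem' := ⟨1, Γ.one_mem, by simp⟩
  add_mem' := by
    rintro x y ⟨g, hg, h1, h2, h3⟩ ⟨g', hg', h1', h2', h3'⟩
    refine ⟨g * g', Γ.mul_mem hg hg', ?_, ?_, ?_⟩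
    · rw [sl_mul_apply, h1, h1']; ring
    · rw [sl_mul_apply, h2, h2']; ring
    · rw [sl_mul_apply, h1, zero_mul, add_zero, abs_mul, h3, h3', Real.exp_add]
  neg_mem' := by
    rintro x ⟨g, hg, h1, h2, h3⟩
    refine ⟨g⁻¹, Γ.inv_mem hg, by rw [sl_inv_01, h1, neg_zero], by rw [sl_inv_10, h2, neg_zero], ?_⟩
    have hd := sl_det g
    rw [h1, zero_mul, sub_zero] at hd
    rw [sl_inv_00, Real.exp_neg, ← h3]
    apply eq_inv_of_mul_eq_one_right
    rw [← abs_mul, hd, abs_one]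

lemma exists_diagLogs_eq_zmultiples {Γ : Subgroup SL(2, ℝ)} (hΓ : ActsDiscretely Γ) :
    ∃ b, diagLogs Γ = AddSubgroup.zmultiples b := by
  have hfin : {x : ℝ | x ∈ diagLogs Γ ∧ x ∈ Set.Ioo (0 : ℝ) 1}.Finite := by
    refine ((hΓ UpperHalfPlane.I (Real.exp 1 ^ 2 + 1)).image
      (fun g => Real.log |g 0 0|)).subset ?_
    rintro x ⟨⟨g, hg, h1, h2, h3⟩, hx0, hx1⟩
    refine ⟨g, ⟨hg, (dist_le_two_mul_cosh _ _).trans ?_⟩, by simp only [h3, Real.log_exp]⟩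
    have hd := sl_det g
    rw [h1, zero_mul, sub_zero] at hd
    rw [cosh_dist_I_smul, h1, h2]
    have e1 : g 0 0 ^ 2 ≤ Real.exp 1 ^ 2 := by
      rw [← sq_abs, h3]
      exact pow_le_pow_left₀ (Real.exp_pos _).le (Real.exp_le_exp.mpr hx1.le) 2
    have e2 : 1 ≤ g 0 0 ^ 2 := by
      rw [← sq_abs, h3]
      exact one_le_pow₀ (Real.one_le_exp hx0.le)
    have e3 : g 0 0 ^ 2 * g 1 1 ^ 2 = 1 := by rw [← mul_pow, hd, one_pow]
    have e4 : g 1 1 ^ 2 ≤ 1 := by nlinarith [sq_nonneg (g 1 1)]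
    linarith
  have hiso : ∃ a : ℝ, 0 < a ∧ Disjoint (diagLogs Γ : Set ℝ) (Set.Ioo 0 a) := by
    rcases Set.eq_empty_or_nonempty {x : ℝ | x ∈ diagLogs Γ ∧ x ∈ Set.Ioo (0 : ℝ) 1} with h | h
    · refine ⟨1, one_pos, Set.disjoint_left.mpr fun x h1 h2 => ?_⟩
      have : x ∈ {x : ℝ | x ∈ diagLogs Γ ∧ x ∈ Set.Ioo (0 : ℝ) 1} := ⟨h1, h2⟩
      rw [h] at this; exact this
    · obtain ⟨a, ⟨ha, ha0, ha1⟩, hmin⟩ := hfin.exists_minimal h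
      refine ⟨a, ha0, Set.disjoint_left.mpr fun x h1 h2 => ?_⟩
      have := hmin (y := x) ⟨h1, h2.1, h2.2.trans ha1⟩ h2.2.le
      exact absurd h2.2 (not_lt.mpr this)
  obtain ⟨a, ha, hd⟩ := hiso
  obtain ⟨b, hb⟩ := AddSubgroup.cyclic_of_isolated_zero ha hd
  exact ⟨b, by rw [hb, AddSubgroup.zmultiples_eq_closure]⟩

lemma inv_eq_neg_of_tr {α : SL(2, ℝ)} (h : tr α = 0) : α⁻¹ = -α := by
  unfold tr at h
  rw [sl_ext_iff]
  simp only [sl_inv_00, sl_inv_01, sl_inv_10, sl_inv_11, sl_neg_apply]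
  refine ⟨?_, ?_, ?_, ?_⟩ <;> first | trivial | linarith

lemma tr_zero_nonTriv {α : SL(2, ℝ)} (h : tr α = 0) : NonTriv α :=
  nonTriv_of_tr (by rw [h]; norm_num)

/-- Half-turns inverting a diagonal element are antidiagonal. -/
lemma antidiag_of_inverts {h α : SL(2, ℝ)} (hn : NonTriv h) (h01 : h 0 1 = 0) (h10 : h 1 0 = 0)
    (hinv : α * h * α⁻¹ = h⁻¹) : α 0 0 = 0 ∧ α 1 1 = 0 := by
  have k : α * h = h⁻¹ * α := by rw [← hinv]; group
  have hdh := sl_det h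
  rw [sl_ext_iff] at k
  simp only [sl_mul_apply, sl_inv_00, sl_inv_01, sl_inv_10, sl_inv_11, h01, h10] at k
  obtain ⟨k1, -, -, k4⟩ := k
  have hne : h 0 0 - h 1 1 ≠ 0 := fun h0 => nonTriv_iff.mp hn ⟨h01, h10, by linarith⟩
  constructor
  · have : α 0 0 * (h 0 0 - h 1 1) = 0 := by linarith
    exact (mul_eq_zero.mp this).resolve_right hne
  · have : α 1 1 * (h 0 0 - h 1 1) = 0 := by linarith
    exact (mul_eq_zero.mp this).resolve_right hne

/-- An antidiagonal half-turn fixes `i |α 0 1|`, so the logarithm is the position of its centre on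
the imaginary axis. The product of two of them is diagonal. -/
lemma log_sub_mem_diagLogs {Γ : Subgroup SL(2, ℝ)} {α β : SL(2, ℝ)} (hα : α ∈ Γ) (hβ : β ∈ Γ)
    (ha0 : α 0 0 = 0) (ha1 : α 1 1 = 0) (hb0 : β 0 0 = 0) (hb1 : β 1 1 = 0) :
    Real.log |β 0 1| - Real.log |α 0 1| ∈ diagLogs Γ := by
  have hda := sl_det α
  have hdb := sl_det β
  rw [ha0, ha1] at hda
  rw [hb0, hb1] at hdb
  have hane : α 0 1 ≠ 0 := by intro h; rw [h] at hda; norm_num at hda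
  have hbne : β 0 1 ≠ 0 := by intro h; rw [h] at hdb; norm_num at hdb
  refine ⟨β * α, Γ.mul_mem hβ hα, ?_, ?_, ?_⟩
  · rw [sl_mul_apply, hb0, ha1]; ring
  · rw [sl_mul_apply, hb1, ha0]; ring
  · rw [sl_mul_apply, ha0, mul_zero, zero_add, Real.exp_sub, Real.exp_log (abs_pos.mpr hbne),
      Real.exp_log (abs_pos.mpr hane), ← abs_div]
    have : β 0 1 * α 1 0 = -(β 0 1 / α 0 1) := by field_simp; linarith
    rw [this, abs_neg]

/-- A diagonal `g` multiplies the axis by `(g 0 0)²`, so it shifts positions by twice its logarithm.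
This doubling is the source of the parity argument. -/
lemma exists_smul_eq_of_antidiag {Γ : Subgroup SL(2, ℝ)} {α β : SL(2, ℝ)}
    (ha0 : α 0 0 = 0) (ha1 : α 1 1 = 0) (hb0 : β 0 0 = 0) (hb1 : β 1 1 = 0) {p q : ℍ}
    (hp : α • p = p) (hq : β • q = q) {y : ℝ} (hy : y ∈ diagLogs Γ)
    (h : Real.log |β 0 1| - Real.log |α 0 1| = y + y) : ∃ γ ∈ Γ, γ • p = q := by
  obtain ⟨g, hg, h1, h2, h3⟩ := hy
  refine ⟨g, hg, ?_⟩
  have hda := sl_det α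
  have hdb := sl_det β
  have hdg := sl_det g
  rw [ha0, ha1] at hda
  rw [hb0, hb1] at hdb
  rw [h1] at hdg
  have hane : α 0 1 ≠ 0 := by intro h; rw [h] at hda; norm_num at hda
  have hbne : β 0 1 ≠ 0 := by intro h; rw [h] at hdb; norm_num at hdb
  have hsq : |β 0 1| = g 0 0 ^ 2 * |α 0 1| := by
    rw [← sq_abs, h3, sq, ← Real.exp_add, ← h, Real.exp_sub, Real.exp_log (abs_pos.mpr hbne),
      Real.exp_log (abs_pos.mpr hane)]
    have := abs_pos.mpr hane
    field_simp
  have hfix : (g * α * g⁻¹) • (g • p) = g • p := by rw [conj_smul_smul, hp]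
  have hβn : NonTriv β := tr_zero_nonTriv (by unfold tr; rw [hb0, hb1, add_zero])
  have hc01 : (g * α * g⁻¹) 0 1 = g 0 0 ^ 2 * α 0 1 := by
    simp only [sl_mul_apply, sl_inv_01, sl_inv_11, h1, ha0, ha1]; ring
  have hc00 : (g * α * g⁻¹) 0 0 = 0 := by
    simp only [sl_mul_apply, sl_inv_00, sl_inv_10, h1, h2, ha0]; ring
  have hc11 : (g * α * g⁻¹) 1 1 = 0 := by
    simp only [sl_mul_apply, sl_inv_01, sl_inv_11, h1, h2, ha1]; ring
  have hdc := sl_det (g * α * g⁻¹)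
  generalize g * α * g⁻¹ = ρ at *
  rw [hc00, hc11] at hdc
  have habs : |β 0 1| = |ρ 0 1| := by
    rw [hc01, abs_mul, abs_of_nonneg (sq_nonneg (g 0 0)), hsq]
  have hρ : ρ = β ∨ ρ = -β := by
    rcases abs_eq_abs.mp habs with h | h
    · left
      have h10 : ρ 1 0 = β 1 0 := by
        apply mul_left_cancel₀ hbne
        rw [h] at hdb ⊢; linarith
      rw [sl_ext_iff]; exact ⟨by rw [hc00, hb0], h.symm, h10, by rw [hc11, hb1]⟩
    · right
      have h10 : ρ 1 0 = -β 1 0 := by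
        apply mul_left_cancel₀ hbne
        rw [h] at hdb ⊢; linarith
      rw [sl_ext_iff]
      simp only [sl_neg_apply]
      exact ⟨by rw [hc00, hb0, neg_zero], by rw [h, neg_neg], h10, by rw [hc11, hb1, neg_zero]⟩
  refine fixed_unique hβn ?_ hq
  rcases hρ with h | h
  · rwa [h] at hfix
  · rwa [h, sl_neg_smul] at hfix

/-- Positions of centres differ by multiples of the generator `b`, and even multiples give the same
orbit; among three positions two have the same parity. -/
lemma exists_smul_eq_of_three_antidiag {Γ : Subgroup SL(2, ℝ)} (hΓ : ActsDiscretely Γ)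
    {h : SL(2, ℝ)} (hn : NonTriv h) (h01 : h 0 1 = 0) (h10 : h 1 0 = 0)
    {α : Fin 3 → SL(2, ℝ)} {p : Fin 3 → ℍ} (hα : ∀ i, α i ∈ Γ) (hp : ∀ i, α i • p i = p i)
    (hinv : ∀ i, α i * h * (α i)⁻¹ = h⁻¹) :
    ∃ i j, i ≠ j ∧ ∃ γ ∈ Γ, γ • p i = p j := by
  have ha := fun i => antidiag_of_inverts hn h01 h10 (hinv i)
  have hmem : ∀ i j, Real.log |α j 0 1| - Real.log |α i 0 1| ∈ diagLogs Γ := fun i j =>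
    log_sub_mem_diagLogs (hα i) (hα j) (ha i).1 (ha i).2 (ha j).1 (ha j).2
  obtain ⟨b, hb⟩ := exists_diagLogs_eq_zmultiples hΓ
  have hfin : ∀ i j, ∀ k : ℤ, Real.log |α j 0 1| - Real.log |α i 0 1| = (k + k : ℤ) • b →
      ∃ γ ∈ Γ, γ • p i = p j := by
    intro i j k hk
    refine exists_smul_eq_of_antidiag (ha i).1 (ha i).2 (ha j).1 (ha j).2 (hp i) (hp j)
      (y := k • b) ?_ (by rw [hk, add_smul])
    rw [hb]; exact AddSubgroup.mem_zmultiples_iff.mpr ⟨k, rfl⟩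
  have h1 := hmem 0 1
  have h2 := hmem 0 2
  rw [hb, AddSubgroup.mem_zmultiples_iff] at h1 h2
  obtain ⟨k, hk⟩ := h1
  obtain ⟨l, hl⟩ := h2
  rcases Int.even_or_odd k with ⟨m, hm⟩ | hk'
  · exact ⟨0, 1, by decide, hfin 0 1 m (by rw [← hk, hm])⟩
  · rcases Int.even_or_odd l with ⟨m, hm⟩ | hl'
    · exact ⟨0, 2, by decide, hfin 0 2 m (by rw [← hl, hm])⟩
    · obtain ⟨m, hm⟩ := hl'.sub_odd hk'
      refine ⟨1, 2, by decide, hfin 1 2 m ?_⟩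
      rw [← hm, sub_smul, hk, hl]; ring

lemma exists_smul_eq_of_three_halfTurns {Γ : Subgroup SL(2, ℝ)} (hΓ : ActsDiscretely Γ)
    {h : SL(2, ℝ)} (hn : NonTriv h)
    {α : Fin 3 → SL(2, ℝ)} {p : Fin 3 → ℍ} (hα : ∀ i, α i ∈ Γ) (hp : ∀ i, α i • p i = p i)
    (ht : ∀ i, tr (α i) = 0) (hinv : ∀ i, α i * h * (α i)⁻¹ = h⁻¹) :
    ∃ i j, i ≠ j ∧ ∃ γ ∈ Γ, γ • p i = p j := by
  obtain ⟨u, hu⟩ : ∃ u : SL(2, ℝ), u • UpperHalfPlane.I = p 0 :=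
    ⟨(p 0).toSL2R, UpperHalfPlane.toSL2R_smul_I _⟩
  have hinv' : ∀ (v : SL(2, ℝ)) (i : Fin 3),
      (v⁻¹ * α i * v) * (v⁻¹ * h * v) * (v⁻¹ * α i * v)⁻¹ = (v⁻¹ * h * v)⁻¹ := by
    intro v i
    calc _ = v⁻¹ * (α i * h * (α i)⁻¹) * v := by group
      _ = _ := by rw [hinv]; group
  have hfix : ∀ (v : SL(2, ℝ)) (i : Fin 3), (v⁻¹ * α i * v) • (v⁻¹ • p i) = v⁻¹ • p i := by
    intro v i
    rw [mul_smul, mul_smul, smul_inv_smul, hp]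
  have hsym : (u⁻¹ * h * u) 0 1 = (u⁻¹ * h * u) 1 0 := by
    have h1 := hfix u 0
    rw [← hu, inv_smul_smul] at h1
    refine (halfTurn_inverts_iff h1 ?_).mp (hinv' u 0)
    have := tr_conj u⁻¹ (α 0)
    rw [inv_inv] at this
    rw [this, ht]
  obtain ⟨k, -, hk1, hk2⟩ := exists_rotation_diag hsym
  have hassoc : k⁻¹ * (u⁻¹ * h * u) * k = (u * k)⁻¹ * h * (u * k) := by group
  rw [hassoc] at hk1 hk2
  obtain ⟨i, j, hij, γ, hγ, hγp⟩ := exists_smul_eq_of_three_antidiag (hΓ.conjBy (u * k))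
    (hn.conj' (u * k)) hk1 hk2 (fun i => mem_conjBy' (hα i)) (hfix (u * k)) (hinv' (u * k))
  refine ⟨i, j, hij, (u * k) * γ * (u * k)⁻¹, hγ, ?_⟩
  rw [mul_smul, mul_smul, hγp, smul_inv_smul]

end HalfTurnOrbits

/-! ### Which small displacements can occur at one point. -/

section Overlap

local notation "gl" => Matrix.SpecialLinearGroup.mapGL (n := Fin 2) (R := ℝ) ℝ

variable {Γ : Subgroup SL(2, ℝ)} {ε : ℝ} {z : ℍ}

lemma Parab.tr_ne_zero {e : SL(2, ℝ)} (h : Parab e) : tr e ≠ 0 := by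
  intro h0
  have := h.2
  rw [h0] at this
  norm_num at this

lemma Parab.commute (hΓ : ActsDiscretely Γ) (hε : ε ≤ 1 / 180) {e g : SL(2, ℝ)} (he : e ∈ Γ)
    (hp : Parab e) (hd : dist z (e • z) ≤ ε) (hg : g ∈ Γ) (hdg : dist z (g • z) ≤ ε) :
    g * e = e * g := by
  rcases margulis hΓ he hg hp.1 hp.tr_ne_zero (z := z) (by linarith) (by linarith) with
    h | ⟨-, -, h⟩
  · exact h
  · rw [hp.2] at h
    exact absurd h (lt_irrefl _)

lemma cusp_eq_of_overlap (hΓ : ActsDiscretely Γ) (hε : ε ≤ 1 / 180) {e e' : SL(2, ℝ)}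
    {c c' : OnePoint ℝ} (he : e ∈ Γ) (hp : Parab e) (hc : gl e • c = c) (hd : dist z (e • z) ≤ ε)
    (he' : e' ∈ Γ) (hp' : Parab e') (hc' : gl e' • c' = c') (hd' : dist z (e' • z) ≤ ε) :
    c = c' := by
  have hcomm := hp.commute hΓ hε he hd he' hd'
  have h1 : gl e • (gl e' • c) = gl e' • c := by
    rw [← mul_smul, ← map_mul, ← hcomm, map_mul, mul_smul, hc]
  have hP := parab_iff.mpr hp
  have hP' := parab_iff.mpr hp'
  have h2 : gl e' • c = c := by
    rw [hP.smul_eq_self_iff.mp h1, ← hP.smul_eq_self_iff.mp hc]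
  rw [hP'.smul_eq_self_iff.mp h2, ← hP'.smul_eq_self_iff.mp hc']

lemma not_cusp_cone_overlap (hΓ : ActsDiscretely Γ) (hε : ε ≤ 1 / 180) {e e' : SL(2, ℝ)}
    {p : ℍ} (he : e ∈ Γ) (hp : Parab e) (hd : dist z (e • z) ≤ ε)
    (he' : e' ∈ Γ) (hn' : NonTriv e') (hd' : dist z (e' • z) ≤ ε) (hr : ConeRel Γ p e') :
    False := by
  have hcomm := hp.commute hΓ hε he hd he' hd'
  obtain ⟨t, ht, hD⟩ := exists_discr_eq_of_commute hp.1 hn' hcomm.symm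
  rw [hp.2, sub_self, mul_zero] at hD
  rcases hr with h | ⟨-, -, -, -, -, h⟩
  · have := tr_sq_lt_of_fixed hn' h
    linarith
  · linarith

/-- By Margulis `e'` commutes with `e`, hence fixes `p`. It is then not hyperbolic, so `ConeRel`
says that it fixes `p'` too. -/
lemma eq_of_elliptic_overlap (hΓ : ActsDiscretely Γ) (hε : ε ≤ 1 / 180) {e e' : SL(2, ℝ)}
    {p p' : ℍ} (he : e ∈ Γ) (hn : NonTriv e) (ht : tr e ≠ 0) (hp : e • p = p)
    (hd : dist z (e • z) ≤ ε)
    (he' : e' ∈ Γ) (hn' : NonTriv e') (hd' : dist z (e' • z) ≤ ε) (hr : ConeRel Γ p' e') :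
    p = p' := by
  have h4 := tr_sq_lt_of_fixed hn hp
  rcases margulis hΓ he he' hn ht (z := z) (by linarith) (by linarith) with h | ⟨-, -, h⟩
  · have hfix := smul_eq_iff_commute_of_fixed hn hp h.symm
    rcases hr with h' | ⟨-, -, -, -, -, h'⟩
    · exact fixed_unique hn' hfix h'
    · have := tr_sq_lt_of_fixed hn' hfix
      linarith
  · linarith

/-- The half-turn `α` around `p` belongs to `Γ`, and either moves `z` little, or inverts a
hyperbolic element of `Γ` that does so. -/
def HalfTurnNear (Γ : Subgroup SL(2, ℝ)) (ε : ℝ) (z p : ℍ) (α : SL(2, ℝ)) : Prop :=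
  α ∈ Γ ∧ α • p = p ∧ tr α = 0 ∧ (dist z (α • z) ≤ ε ∨
    ∃ e ∈ Γ, dist z (e • z) ≤ ε ∧ α * e * α⁻¹ = e⁻¹ ∧ 4 < tr e ^ 2)

/-- If `α` moves `z` little, Margulis for `h` and `α` suffices, as a half-turn cannot commute with a
hyperbolic element. Otherwise `h` commutes with the element `e` inverted by `α`, so `h = s + t e` is
inverted with it. -/
lemma HalfTurnNear.inverts (hΓ : ActsDiscretely Γ) (hε : ε ≤ 1 / 180) (hε0 : 0 < ε) {p : ℍ}
    {α h : SL(2, ℝ)} (hα : HalfTurnNear Γ ε z p α) (hh : h ∈ Γ) (ht : 4 < tr h ^ 2)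
    (hd : dist z (h • z) ≤ 2 * ε) : α * h * α⁻¹ = h⁻¹ := by
  obtain ⟨hαΓ, hαp, hαt, hα⟩ := hα
  have hn : NonTriv h := nonTriv_of_tr ht.ne'
  have ht0 : tr h ≠ 0 := by intro h0; rw [h0] at ht; norm_num at ht
  rcases hα with hα | ⟨e, he, hde, hinv, het⟩
  · rcases margulis hΓ hh hαΓ hn ht0 (z := z) (by linarith) (by linarith) with hc | ⟨-, hc, -⟩
    · have := tr_sq_lt_of_fixed hn
        (smul_eq_iff_commute_of_fixed (tr_zero_nonTriv hαt) hαp hc)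
      linarith
    · exact hc
  · have hne : NonTriv e := nonTriv_of_tr het.ne'
    rcases margulis hΓ hh he hn ht0 (z := z) (by linarith) (by linarith) with hc | ⟨hc, -, -⟩
    · obtain ⟨s, t, e1, e2, e3, e4⟩ := exists_eq_of_commute hne hc
      have k : α * e = e⁻¹ * α := by rw [← hinv]; group
      rw [sl_ext_iff] at k
      simp only [sl_mul_apply, sl_inv_00, sl_inv_01, sl_inv_10, sl_inv_11] at k
      obtain ⟨k1, k2, k3, k4⟩ := k
      rw [mul_inv_eq_iff_eq_mul, sl_ext_iff]
      simp only [sl_mul_apply, sl_inv_00, sl_inv_01, sl_inv_10, sl_inv_11, e1, e2, e3, e4]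
      refine ⟨?_, ?_, ?_, ?_⟩
      · linear_combination t * k1
      · linear_combination t * k2
      · linear_combination t * k3
      · linear_combination t * k4
    · rw [hc] at het; norm_num at het

lemma four_lt_tr_sq_of_inverted {p : ℍ} {α h : SL(2, ℝ)} (hp : α • p = p) (ht : tr α = 0)
    (hn : NonTriv h) (hinv : α * h * α⁻¹ = h⁻¹) : 4 < tr h ^ 2 := by
  obtain ⟨u, rfl⟩ : ∃ u : SL(2, ℝ), u • UpperHalfPlane.I = p :=
    ⟨p.toSL2R, UpperHalfPlane.toSL2R_smul_I p⟩
  have htc : ∀ x, tr (u⁻¹ * x * u) = tr x := fun x => by simpa using tr_conj u⁻¹ x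
  have h1 : (u⁻¹ * α * u) • UpperHalfPlane.I = UpperHalfPlane.I := by
    rw [mul_smul, mul_smul, hp, inv_smul_smul]
  have h2 : (u⁻¹ * α * u) * (u⁻¹ * h * u) * (u⁻¹ * α * u)⁻¹ = (u⁻¹ * h * u)⁻¹ := by
    calc _ = u⁻¹ * (α * h * α⁻¹) * u := by group
      _ = _ := by rw [hinv]; group
  rw [← htc h]
  exact four_lt_tr_sq_of_symm (hn.conj' u) ((halfTurn_inverts_iff h1 (by rw [htc, ht])).mp h2)

/-- If no hyperbolic element is at hand, the product of the two half-turns is one: it is nontrivial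
because the centres differ, and `α` inverts it. Its displacement is the reason for the bound `2 ε`.
-/
lemma HalfTurnNear.exists_hyperbolic (hε0 : 0 < ε)
    {p q : ℍ} {α β : SL(2, ℝ)} (hα : HalfTurnNear Γ ε z p α) (hβ : HalfTurnNear Γ ε z q β)
    (hpq : p ≠ q) : ∃ h ∈ Γ, 4 < tr h ^ 2 ∧ dist z (h • z) ≤ 2 * ε := by
  obtain ⟨hαΓ, hαp, hαt, hα⟩ := hα
  obtain ⟨hβΓ, hβq, hβt, hβ⟩ := hβ
  rcases hα with hα | ⟨e, he, hde, -, het⟩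
  · rcases hβ with hβ | ⟨e, he, hde, -, het⟩
    · refine ⟨α * β, Γ.mul_mem hαΓ hβΓ, ?_, by linarith [dist_smul_mul_le α β z]⟩
      refine four_lt_tr_sq_of_inverted hαp hαt ?_ ?_
      · constructor
        · intro h1
          apply hpq
          rw [eq_inv_of_mul_eq_one_right h1, inv_smul_eq_iff] at hβq
          exact fixed_unique (tr_zero_nonTriv hαt) hαp hβq.symm
        · intro h1
          apply hpq
          have : β = -α⁻¹ := by rw [← inv_mul_cancel_left α β, h1]; simp
          rw [this, sl_neg_smul, inv_smul_eq_iff] at hβq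
          exact fixed_unique (tr_zero_nonTriv hαt) hαp hβq.symm
      · rw [mul_inv_rev, inv_eq_neg_of_tr hβt, ← mul_assoc]
        congr 1
        have : α * α = -1 := by
          rw [← neg_inj, ← mul_neg, ← inv_eq_neg_of_tr hαt, mul_inv_cancel, neg_neg]
        rw [this, neg_one_mul]
    · exact ⟨e, he, het, by linarith⟩
  · exact ⟨e, he, het, by linarith⟩

lemma three_cone_overlap (hΓ : ActsDiscretely Γ) (hε : ε ≤ 1 / 180) (hε0 : 0 < ε)
    {p : Fin 3 → ℍ} {e : Fin 3 → SL(2, ℝ)} (he : ∀ i, e i ∈ Γ) (hn : ∀ i, NonTriv (e i))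
    (hd : ∀ i, dist z (e i • z) ≤ ε) (hr : ∀ i, ConeRel Γ (p i) (e i)) :
    ∃ i j, i ≠ j ∧ ∃ γ ∈ Γ, γ • p i = p j := by
  by_contra hcon
  push Not at hcon
  have hne : ∀ i j, i ≠ j → p i ≠ p j := by
    intro i j hij h
    exact hcon i j hij 1 Γ.one_mem (by rw [one_smul, h])
  have hnear : ∀ i, ∃ α, HalfTurnNear Γ ε z (p i) α := by
    intro i
    rcases hr i with h | ⟨α, h1, h2, h3, h4, h5⟩
    · by_cases ht : tr (e i) = 0
      · exact ⟨e i, he i, h, ht, Or.inl (hd i)⟩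
      · exfalso
        obtain ⟨j, hj⟩ : ∃ j, i ≠ j := (exists_ne i).imp fun _ h => h.symm
        exact hne i j hj (eq_of_elliptic_overlap hΓ hε (he i) (hn i) ht h (hd i) (he j) (hn j)
          (hd j) (hr j))
    · exact ⟨α, h1, h2, h3, Or.inr ⟨e i, he i, hd i, h4, h5⟩⟩
  choose α hα using hnear
  obtain ⟨h, hh, ht, hdh⟩ := (hα 0).exists_hyperbolic hε0 (hα 1) (hne 0 1 (by decide))
  obtain ⟨i, j, hij, γ, hγ, hγp⟩ := exists_smul_eq_of_three_halfTurns hΓ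
    (nonTriv_of_tr ht.ne') (fun i => (hα i).1) (fun i => (hα i).2.1) (fun i => (hα i).2.2.1)
    (fun i => (hα i).inverts hΓ hε hε0 hh ht hdh)
  exact hcon i j hij γ hγ hγp

end Overlap

/-! ### Assembling the regions in the quotient. -/

section Regions

local notation "gl" => Matrix.SpecialLinearGroup.mapGL (n := Fin 2) (R := ℝ) ℝ

variable {Γ : Subgroup SL(2, ℝ)} {ε : ℝ}

lemma proj_eq_iff {z w : ℍ} : proj Γ z = proj Γ w ↔ ∃ γ ∈ Γ, γ • w = z := by
  unfold proj
  rw [Quotient.eq]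
  change z ∈ MulAction.orbit Γ w ↔ _
  constructor
  · rintro ⟨⟨γ, hγ⟩, h⟩
    exact ⟨γ, hγ, h⟩
  · rintro ⟨γ, hγ, h⟩
    exact ⟨⟨γ, hγ⟩, h⟩

lemma proj_smul {γ : SL(2, ℝ)} (hγ : γ ∈ Γ) (z : ℍ) : proj Γ (γ • z) = proj Γ z :=
  proj_eq_iff.mpr ⟨γ, hγ, rfl⟩

lemma proj_surjective : Function.Surjective (proj Γ) := Quotient.mk_surjective

lemma ball_eq_image (p : ℍ) (r : ℝ) : ball Γ (proj Γ p) r = proj Γ '' Metric.ball p r := by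
  ext y
  constructor
  · rintro ⟨z, w, h1, h2, h3⟩
    obtain ⟨γ, hγ, rfl⟩ := proj_eq_iff.mp h1
    refine ⟨γ⁻¹ • w, ?_, by rw [proj_smul (Γ.inv_mem hγ), h2]⟩
    rw [Metric.mem_ball, dist_comm, ← sl_dist_smul γ, smul_inv_smul]
    exact h3
  · rintro ⟨w, h1, h2⟩
    exact ⟨p, w, rfl, h2, by rwa [Metric.mem_ball, dist_comm] at h1⟩

open scoped Pointwise in
lemma volume_ball (z : ℍ) (r : ℝ) :
    volume (Metric.ball z r) = volume (Metric.ball UpperHalfPlane.I r) := by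
  have h1 : z.toSL2R • Metric.ball UpperHalfPlane.I r = Metric.ball z r := by
    ext w
    rw [Set.mem_smul_set_iff_inv_smul_mem, Metric.mem_ball, Metric.mem_ball,
      ← sl_dist_smul z.toSL2R, smul_inv_smul, UpperHalfPlane.toSL2R_smul_I]
  have h2 : (gl z.toSL2R) • Metric.ball UpperHalfPlane.I r = Metric.ball z r := h1
  rw [← h2, measure_smul]

/-- Two equivalent points of the ball lie at distance less than ε/2 from `w`, so a nontrivial
element relating them would move `w` by less than ε. The ball therefore embeds. -/
lemma volume_ball_le_vol {w w' : ℍ} (hw : dist w' w ≤ ε / 4)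
    (hthick : ∀ γ ∈ Γ, NonTriv γ → ε ≤ dist w (γ • w)) {A : Set (Orbifold Γ)}
    (hA : proj Γ '' Metric.ball w' (ε / 4) ⊆ A) :
    volume (Metric.ball UpperHalfPlane.I (ε / 4)) ≤ vol Γ A := by
  rw [← volume_ball w']
  refine le_iSup_of_le (Metric.ball w' (ε / 4)) <| le_iSup_of_le Metric.isOpen_ball.measurableSet <|
    le_iSup_of_le (Set.image_subset_iff.mp hA) <| le_iSup_of_le ?_ le_rfl
  intro x hx y hy hxy
  obtain ⟨γ, hγ, rfl⟩ := proj_eq_iff.mp hxy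
  rw [Metric.mem_ball] at hx hy
  by_cases hn : NonTriv γ
  · exfalso
    have h1 := hthick γ hγ hn
    have h2 : dist w (γ • w) ≤ dist w (γ • y) + dist (γ • y) (γ • w) := dist_triangle _ _ _
    rw [sl_dist_smul] at h2
    have h3 := dist_triangle y w' w
    have h4 := dist_triangle (γ • y) w' w
    rw [dist_comm w (γ • y)] at h2
    linarith
  · unfold NonTriv at hn
    rw [not_and_or, not_not, not_not] at hn
    rcases hn with rfl | rfl
    · rw [one_smul]
    · rw [sl_neg_smul, one_smul]

/-- A point of the plane lies in the region of the cone point or cusp `s`, because of some small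
displacement. -/
def Witness (Γ : Subgroup SL(2, ℝ)) (ε : ℝ) (z : ℍ) : conePoints Γ ⊕ Cusps Γ → Prop
  | Sum.inl x => ∃ p : ℍ, ∃ e ∈ Γ, proj Γ p = x ∧ NonTriv e ∧ dist z (e • z) ≤ ε ∧ ConeRel Γ p e
  | Sum.inr k => ∃ q : cuspsSubMulAction (toGL Γ), ∃ e ∈ Γ, (Quotient.mk _ q : Cusps Γ) = k ∧
      Parab e ∧ gl e • (q : OnePoint ℝ) = q ∧ dist z (e • z) ≤ ε

lemma Witness.smul {z : ℍ} {s : conePoints Γ ⊕ Cusps Γ} (h : Witness Γ ε z s) {γ : SL(2, ℝ)}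
    (hγ : γ ∈ Γ) : Witness Γ ε (γ • z) s := by
  have hc : ∀ e ∈ Γ, γ * e * γ⁻¹ ∈ Γ := fun e he => Γ.mul_mem (Γ.mul_mem hγ he) (Γ.inv_mem hγ)
  rcases s with x | k
  · obtain ⟨p, e, he, h1, h2, h3, h4⟩ := h
    refine ⟨γ • p, γ * e * γ⁻¹, hc e he, by rw [proj_smul hγ, h1], h2.conj γ,
      by rwa [dist_conj_smul_smul], ?_⟩
    have : conjBy γ Γ = Γ := by
      ext x
      rw [mem_conjBy, Γ.mul_mem_cancel_right (Γ.inv_mem hγ), Γ.mul_mem_cancel_left hγ]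
    exact ConeRel.conj (by rwa [this])
  · obtain ⟨q, e, he, h1, h2, h3, h4⟩ := h
    refine ⟨(⟨gl γ, ⟨γ, hγ, rfl⟩⟩ : toGL Γ) • q, γ * e * γ⁻¹, hc e he, ?_, h2.conj γ, ?_,
      by rwa [dist_conj_smul_smul]⟩
    · rw [← h1]
      exact Quotient.sound ⟨_, rfl⟩
    · change gl (γ * e * γ⁻¹) • (gl γ • (q : OnePoint ℝ)) = gl γ • (q : OnePoint ℝ)
      rw [map_mul, map_mul, map_inv, mul_smul, mul_smul, inv_smul_smul, h3]

lemma Witness.eq_of_cusp (hΓ : ActsDiscretely Γ) (hε : ε ≤ 1 / 180) {z : ℍ} {k : Cusps Γ}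
    {s : conePoints Γ ⊕ Cusps Γ} (h : Witness Γ ε z (Sum.inr k)) (h' : Witness Γ ε z s) :
    s = Sum.inr k := by
  obtain ⟨q, e, he, h1, h2, h3, h4⟩ := h
  rcases s with x | k'
  · obtain ⟨p, e', he', -, h2', h3', h4'⟩ := h'
    exact (not_cusp_cone_overlap hΓ hε he h2 h4 he' h2' h3' h4').elim
  · obtain ⟨q', e', he', h1', h2', h3', h4'⟩ := h'
    have : q' = q := Subtype.ext (cusp_eq_of_overlap hΓ hε he' h2' h3' h4' he h2 h3 h4)
    rw [← h1, ← h1', this]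

lemma Witness.not_three (hΓ : ActsDiscretely Γ) (hε : ε ≤ 1 / 180) (hε0 : 0 < ε) {z : ℍ}
    {s : Fin 3 → conePoints Γ ⊕ Cusps Γ} (hs : Function.Injective s)
    (h : ∀ i, Witness Γ ε z (s i)) : False := by
  have hinl : ∀ i, ∃ x, s i = Sum.inl x := by
    intro i
    rcases hi : s i with x | k
    · exact ⟨x, rfl⟩
    · exfalso
      obtain ⟨j, hj⟩ := exists_ne i
      have := Witness.eq_of_cusp hΓ hε (hi ▸ h i) (h j)
      exact hj (hs (this.trans hi.symm))
  choose x hx using hinl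
  have h' : ∀ i, Witness Γ ε z (Sum.inl (x i)) := fun i => hx i ▸ h i
  choose p e he h1 h2 h3 h4 using h'
  obtain ⟨i, j, hij, γ, hγ, hγp⟩ := three_cone_overlap hΓ hε hε0 he h2 h3 h4
  apply hij
  apply hs
  rw [hx, hx]
  congr 1
  apply Subtype.ext
  rw [← h1, ← h1, ← hγp, proj_smul hγ]

theorem exists_isThinRegions (hε0 : 0 < ε) (hε : ε ≤ 1 / 180) (hΓ : ActsDiscretely Γ) {c : ℝ}
    (hc : ENNReal.ofReal c ≤ volume (Metric.ball UpperHalfPlane.I (ε / 4))) :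
    ∃ Ω : conePoints Γ ⊕ Cusps Γ → Set (Orbifold Γ), IsThinRegions Γ ε c Ω := by
  have hcone : ∀ x : conePoints Γ, ∃ (p : ℍ) (r : ℝ), proj Γ p = x ∧ IsConeRadius Γ ε p r := by
    rintro ⟨_, p, ⟨γ, hγ, h1, h2, h3⟩, rfl⟩
    obtain ⟨r, hr⟩ := exists_isConeRadius hΓ hε0 hε ⟨γ, hγ, ⟨h1, h2⟩, h3⟩
    exact ⟨p, r, rfl, hr⟩
  have hcusp : ∀ k : Cusps Γ, ∃ (q : cuspsSubMulAction (toGL Γ)) (H : Set ℍ),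
      (Quotient.mk _ q : Cusps Γ) = k ∧ IsThinHoroball Γ ε q H := by
    intro k
    obtain ⟨q, rfl⟩ := Quotient.mk_surjective k
    obtain ⟨H, hH⟩ := exists_isThinHoroball hΓ hε0 hε q.2
    exact ⟨q, H, rfl, hH⟩
  choose p r hp hr using hcone
  choose q H hq hH using hcusp
  let Ω : conePoints Γ ⊕ Cusps Γ → Set (Orbifold Γ) :=
    Sum.elim (fun x => ball Γ x (r x)) (fun k => proj Γ '' H k)
  have hΩl : ∀ x, Ω (Sum.inl x) = proj Γ '' Metric.ball (p x) (r x) := by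
    intro x
    rw [← ball_eq_image, hp]
    rfl
  -- Witnesses are equivariant, so all regions through a point of the quotient can be compared at a
  -- single lift `z`.
  have hwit : ∀ s z, proj Γ z ∈ Ω s → Witness Γ ε z s := by
    intro s z hz
    obtain ⟨w, hw, hwz⟩ : ∃ w, Witness Γ ε w s ∧ proj Γ w = proj Γ z := by
      rcases s with x | k
      · rw [hΩl] at hz
        obtain ⟨w, h1, h2⟩ := hz
        obtain ⟨e, he, h3, h4, h5⟩ := (hr x).thin w h1
        exact ⟨w, ⟨p x, e, he, hp x, h3, h4, h5⟩, h2⟩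
      · obtain ⟨w, h1, h2⟩ := hz
        obtain ⟨e, he, h3, h4, h5⟩ := (hH k).thin w h1
        exact ⟨w, ⟨q k, e, he, hq k, h3, h4, h5⟩, h2⟩
    obtain ⟨γ, hγ, rfl⟩ := proj_eq_iff.mp hwz.symm
    exact hw.smul hγ
  refine ⟨Ω, ?_, ?_, ?_, ?_, ?_, ?_⟩
  · intro x
    exact ⟨r x, by linarith [(hr x).half_le], rfl⟩
  · intro k
    exact ⟨q k, H k, hq k, (hH k).horoball, rfl⟩
  · intro s y hy
    obtain ⟨z, rfl⟩ := proj_surjective y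
    refine ⟨z, ?_, rfl⟩
    have hw := hwit s z hy
    rcases s with x | k
    · obtain ⟨p, e, he, -, h2, h3, -⟩ := hw
      exact ⟨e, he, h2.1, h2.2, h3⟩
    · obtain ⟨q, e, he, -, h2, -, h3⟩ := hw
      exact ⟨e, he, h2.1.1, h2.1.2, h3⟩
  · intro s
    refine hc.trans ?_
    rcases s with x | k
    · obtain ⟨w, w', h1, h2, h3⟩ := (hr x).thick
      refine volume_ball_le_vol h1 h3 ?_
      rw [hΩl]
      apply Set.image_mono
      apply Metric.ball_subset_ball'
      linarith
    · obtain ⟨w, w', h1, h2, h3⟩ := (hH k).thick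
      exact volume_ball_le_vol h1 h3 (Set.image_mono h2)
  · intro k k' hkk
    rw [Set.disjoint_left]
    intro y hy hy'
    obtain ⟨z, rfl⟩ := proj_surjective y
    exact hkk (Sum.inr_injective
      (Witness.eq_of_cusp hΓ hε (hwit _ z hy') (hwit _ z hy)))
  · intro y
    by_contra hlt
    push Not at hlt
    obtain ⟨z, rfl⟩ := proj_surjective y
    have h3 : (3 : ℕ∞) ≤ {s | proj Γ z ∈ Ω s}.encard := by
      have := Order.add_one_le_of_lt hlt
      norm_num at this
      exact this
    obtain ⟨t, ht, ht3⟩ := Set.exists_subset_encard_eq h3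
    obtain ⟨a, b, c, hab, hac, hbc, rfl⟩ := Set.encard_eq_three.mp ht3
    refine Witness.not_three hΓ hε hε0 (z := z) (s := ![a, b, c]) ?_ ?_
    · intro i j hij
      fin_cases i <;> fin_cases j <;> simp_all
    · intro i
      fin_cases i
      · exact hwit _ z (ht (by simp))
      · exact hwit _ z (ht (by simp))
      · exact hwit _ z (ht (by simp))

end Regions

/-! ### Counting regions by area. -/

section Counting

variable {Γ : Subgroup SL(2, ℝ)}

lemma vol_mono {A B : Set (Orbifold Γ)} (h : A ⊆ B) : vol Γ A ≤ vol Γ B :=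
  iSup_mono fun _ => iSup_mono fun _ => iSup_mono' fun hS =>
    ⟨hS.trans (Set.preimage_mono h), le_rfl⟩

lemma volume_le_vol {A : Set (Orbifold Γ)} {S : Set ℍ} (hS : MeasurableSet S)
    (hA : S ⊆ proj Γ ⁻¹' A) (hinj : Set.InjOn (proj Γ) S) : volume S ≤ vol Γ A :=
  le_iSup_of_le S <| le_iSup_of_le hS <| le_iSup_of_le hA <| le_iSup_of_le hinj le_rfl

lemma ActsDiscretely.countable (hΓ : ActsDiscretely Γ) : (Γ : Set SL(2, ℝ)).Countable := by
  have : (Γ : Set SL(2, ℝ)) ⊆ ⋃ n : ℕ, {γ | γ ∈ Γ ∧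
      dist UpperHalfPlane.I (γ • UpperHalfPlane.I) ≤ n} := by
    intro γ hγ
    obtain ⟨n, hn⟩ := exists_nat_ge (dist UpperHalfPlane.I (γ • UpperHalfPlane.I))
    exact Set.mem_iUnion.mpr ⟨n, hγ, hn⟩
  exact (Set.countable_iUnion fun n : ℕ => (hΓ UpperHalfPlane.I n).countable).mono this

lemma measurableSet_saturation (hΓ : ActsDiscretely Γ) {S : Set ℍ} (hS : MeasurableSet S) :
    MeasurableSet (proj Γ ⁻¹' (proj Γ '' S)) := by
  have : proj Γ ⁻¹' (proj Γ '' S) = ⋃ γ ∈ (Γ : Set SL(2, ℝ)), (fun z : ℍ => γ • z) ⁻¹' S := by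
    ext z
    simp only [Set.mem_preimage, Set.mem_image, Set.mem_iUnion]
    constructor
    · rintro ⟨w, hw, h⟩
      obtain ⟨γ, hγ, rfl⟩ := proj_eq_iff.mp h
      exact ⟨γ, hγ, hw⟩
    · rintro ⟨γ, hγ, h⟩
      exact ⟨γ • z, h, proj_smul hγ z⟩
  rw [this]
  exact MeasurableSet.biUnion hΓ.countable fun γ _ =>
    (continuous_const_smul γ).measurable hS

lemma injOn_iUnion {n : ℕ} {S : Fin n → Set ℍ} (h : ∀ i, Set.InjOn (proj Γ) (S i))
    (hd : ∀ i j, i < j → Disjoint (proj Γ '' S i) (proj Γ '' S j)) :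
    Set.InjOn (proj Γ) (⋃ i, S i) := by
  intro x hx y hy hxy
  obtain ⟨i, hi⟩ := Set.mem_iUnion.mp hx
  obtain ⟨j, hj⟩ := Set.mem_iUnion.mp hy
  rcases lt_trichotomy i j with hij | rfl | hij
  · exact ((Set.disjoint_left.mp (hd i j hij) ⟨x, hi, rfl⟩) ⟨y, hj, hxy.symm⟩).elim
  · exact h i hi hj hxy
  · exact ((Set.disjoint_left.mp (hd j i hij) ⟨y, hj, rfl⟩) ⟨x, hi, hxy⟩).elim

lemma sum_volume_le_vol {n : ℕ} {S : Fin n → Set ℍ} {A : Set (Orbifold Γ)}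
    (hm : ∀ i, MeasurableSet (S i)) (h : ∀ i, Set.InjOn (proj Γ) (S i))
    (hA : ∀ i, S i ⊆ proj Γ ⁻¹' A)
    (hd : ∀ i j, i < j → Disjoint (proj Γ '' S i) (proj Γ '' S j)) :
    ∑ i, volume (S i) ≤ vol Γ A := by
  have hdis : Pairwise (Function.onFun Disjoint S) := by
    have key : ∀ i j, i < j → Disjoint (S i) (S j) := by
      intro i j hij
      rw [Set.disjoint_left]
      intro x hx hx'
      exact (Set.disjoint_left.mp (hd i j hij) ⟨x, hx, rfl⟩) ⟨x, hx', rfl⟩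
    intro i j hij
    rcases lt_or_gt_of_ne hij with h | h
    · exact key i j h
    · exact (key j i h).symm
  rw [← tsum_fintype (L := .unconditional _), ← measure_iUnion hdis hm]
  exact volume_le_vol (MeasurableSet.iUnion hm) (Set.iUnion_subset hA) (injOn_iUnion h hd)

/-- Sets covering every point at most twice have total area at most twice the area of a set
containing them. -/
lemma sum_vol_le_two_mul (hΓ : ActsDiscretely Γ) {n : ℕ} {Ω : Fin n → Set (Orbifold Γ)}
    {A : Set (Orbifold Γ)} (hA : ∀ i, Ω i ⊆ A) (hov : ∀ y, {i | y ∈ Ω i}.encard ≤ 2) {b : ℝ≥0∞}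
    (hb : ∀ i, b < vol Γ (Ω i)) : n * b ≤ 2 * vol Γ A := by
  have hS : ∀ i, ∃ S : Set ℍ, MeasurableSet S ∧ S ⊆ proj Γ ⁻¹' Ω i ∧ Set.InjOn (proj Γ) S ∧
      b < volume S := by
    intro i
    have := hb i
    unfold vol at this
    simp only [lt_iSup_iff] at this
    obtain ⟨S, h1, h2, h3, h4⟩ := this
    exact ⟨S, h1, h2, h3, h4⟩
  choose S hm hsub hinj hbS using hS
  -- `D i` collects the points already met by an earlier region. The pieces `S i \ D i` have
  -- disjoint images, and so do the pieces `S i ∩ D i`, because a common point of two of these would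
  -- lie in three regions.
  let D : Fin n → Set ℍ := fun i => ⋃ j, ⋃ _ : j < i, proj Γ ⁻¹' (proj Γ '' S j)
  have hDm : ∀ i, MeasurableSet (D i) := fun i =>
    MeasurableSet.iUnion fun j => MeasurableSet.iUnion fun _ => measurableSet_saturation hΓ (hm j)
  have hmemD : ∀ i z, z ∈ D i ↔ ∃ j < i, proj Γ z ∈ proj Γ '' S j := by
    intro i z
    simp only [D, Set.mem_iUnion, Set.mem_preimage, exists_prop]
  have hΩS : ∀ i y, y ∈ proj Γ '' S i → y ∈ Ω i := by
    rintro i _ ⟨z, hz, rfl⟩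
    exact hsub i hz
  have h1 : ∑ i, volume (S i \ D i) ≤ vol Γ A := by
    refine sum_volume_le_vol (fun i => (hm i).diff (hDm i))
      (fun i => (hinj i).mono Set.sdiff_subset)
      (fun i => (Set.sdiff_subset.trans (hsub i)).trans (Set.preimage_mono (hA i))) ?_
    intro i j hij
    rw [Set.disjoint_left]
    rintro _ ⟨z, hz, rfl⟩ ⟨w, hw, hwz⟩
    exact hw.2 ((hmemD j w).mpr ⟨i, hij, z, hz.1, hwz.symm⟩)
  have h2 : ∑ i, volume (S i ∩ D i) ≤ vol Γ A := by
    refine sum_volume_le_vol (fun i => (hm i).inter (hDm i))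
      (fun i => (hinj i).mono Set.inter_subset_left)
      (fun i => (Set.inter_subset_left.trans (hsub i)).trans (Set.preimage_mono (hA i))) ?_
    intro i j hij
    rw [Set.disjoint_left]
    rintro _ ⟨z, hz, rfl⟩ ⟨w, hw, hwz⟩
    obtain ⟨k, hk, hkz⟩ := (hmemD i z).mp hz.2
    have hle := hov (proj Γ z)
    have hsub3 : ({k, i, j} : Set (Fin n)) ⊆ {i | proj Γ z ∈ Ω i} := by
      rintro l (rfl | rfl | rfl)
      · exact hΩS _ _ hkz
      · exact hΩS _ _ ⟨z, hz.1, rfl⟩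
      · exact hΩS _ _ ⟨w, hw.1, hwz⟩
    have h3 : ({k, i, j} : Set (Fin n)).encard = 3 :=
      Set.encard_eq_three.mpr ⟨k, i, j, hk.ne, (hk.trans hij).ne, hij.ne, rfl⟩
    have := (Set.encard_le_encard hsub3).trans hle
    rw [h3] at this
    exact absurd this (by norm_num)
  calc n * b = ∑ _i : Fin n, b := by simp
    _ ≤ ∑ i, volume (S i) := Finset.sum_le_sum fun i _ => (hbS i).le
    _ = ∑ i, volume (S i \ D i) + ∑ i, volume (S i ∩ D i) := by
        rw [← Finset.sum_add_distrib]
        refine Finset.sum_congr rfl fun i _ => ?_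
        rw [add_comm, measure_inter_add_sdiff _ (hDm i)]
    _ ≤ vol Γ A + vol Γ A := add_le_add h1 h2
    _ = 2 * vol Γ A := (two_mul _).symm

lemma IsThinRegions.card_mul_le (hΓ : ActsDiscretely Γ) {ε c : ℝ} (hc : 0 < c)
    {Ω : conePoints Γ ⊕ Cusps Γ → Set (Orbifold Γ)} (h : IsThinRegions Γ ε c Ω)
    (t : Finset (conePoints Γ ⊕ Cusps Γ)) :
    t.card * ENNReal.ofReal (c / 2) ≤ 2 * vol Γ (thinLE Γ ε) := by
  let f : Fin t.card → conePoints Γ ⊕ Cusps Γ := fun i => (t.equivFin.symm i : _)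
  have hf : Function.Injective f := Subtype.val_injective.comp t.equivFin.symm.injective
  refine sum_vol_le_two_mul hΓ (Ω := fun i => Ω (f i)) (fun i => h.thin _) ?_ ?_
  · intro y
    refine le_trans ?_ (h.overlap y)
    rw [← hf.encard_image]
    apply Set.encard_le_encard
    rintro _ ⟨i, hi, rfl⟩
    exact hi
  · intro i
    refine lt_of_lt_of_le ?_ (h.vol_ge _)
    -- Halving `c` gives the strict inequality needed to choose an actual set of representatives
    -- below the supremum defining `vol`.
    rw [ENNReal.ofReal_lt_ofReal_iff hc]
    linarith

lemma IsThinRegions.finite (hΓ : ActsDiscretely Γ) (hvol : vol Γ Set.univ < ∞) {ε c : ℝ}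
    (hc : 0 < c) {Ω : conePoints Γ ⊕ Cusps Γ → Set (Orbifold Γ)} (h : IsThinRegions Γ ε c Ω) :
    Finite (conePoints Γ ⊕ Cusps Γ) := by
  by_contra hinf
  rw [not_finite_iff_infinite] at hinf
  have hfin : 2 * vol Γ (thinLE Γ ε) < ∞ :=
    ENNReal.mul_lt_top (by norm_num) ((vol_mono (Set.subset_univ _)).trans_lt hvol)
  have hpos : ENNReal.ofReal (c / 2) ≠ 0 := by
    simpa using hc
  obtain ⟨n, hn⟩ := ENNReal.exists_nat_mul_gt hpos hfin.ne
  obtain ⟨t, ht⟩ := Infinite.exists_subset_card_eq (conePoints Γ ⊕ Cusps Γ) n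
  have := h.card_mul_le hΓ hc t
  rw [ht] at this
  exact absurd hn (not_lt.mpr this)

lemma IsThinRegions.card_le (hΓ : ActsDiscretely Γ) (hvol : vol Γ Set.univ < ∞) {ε c : ℝ}
    (hc : 0 < c) {Ω : conePoints Γ ⊕ Cusps Γ → Set (Orbifold Γ)} (h : IsThinRegions Γ ε c Ω) :
    ((Nat.card (Cusps Γ) + (conePoints Γ).ncard : ℕ) : ℝ≥0∞) * ENNReal.ofReal (c / 2) ≤
      2 * vol Γ (thinLE Γ ε) := by
  have hfin := h.finite hΓ hvol hc
  have : Finite (conePoints Γ) := Finite.of_injective _ (Sum.inl_injective (β := Cusps Γ))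
  have : Finite (Cusps Γ) := Finite.of_injective _ (Sum.inr_injective (α := conePoints Γ))
  have := Fintype.ofFinite (conePoints Γ ⊕ Cusps Γ)
  have h1 := h.card_mul_le hΓ hc Finset.univ
  rw [Finset.card_univ, ← Nat.card_eq_fintype_card, Nat.card_sum] at h1
  rwa [add_comm, ← Nat.card_coe_set_eq]

end Counting

/-! ### The area constant and the asymptotic count. -/

/-- A lower bound for the areas of the thin regions. -/
noncomputable def areaBound (ε : ℝ) : ℝ :=
  -- The minimum with 1 keeps `toReal` away from `∞`.
  (min (volume (Metric.ball UpperHalfPlane.I (ε / 4))) 1).toReal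

lemma areaBound_pos {ε : ℝ} (hε : 0 < ε) : 0 < areaBound ε := by
  refine ENNReal.toReal_pos ?_ ?_
  · have hpos : 0 < volume (Metric.ball UpperHalfPlane.I (ε / 4)) := by
      rw [UpperHalfPlane.volume_eq_lintegral, setLIntegral_pos_iff (by fun_prop)]
      have hopen : IsOpen ((↑) '' Metric.ball UpperHalfPlane.I (ε / 4) : Set ℂ) :=
        UpperHalfPlane.isOpenEmbedding_coe.isOpenMap _ Metric.isOpen_ball
      refine (hopen.measure_pos volume
        ⟨_, _, Metric.mem_ball_self (by positivity), rfl⟩).trans_le (measure_mono ?_)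
      rintro _ ⟨z, hz, rfl⟩
      refine ⟨?_, z, hz, rfl⟩
      simpa using z.im_pos.ne'
    exact (lt_min hpos one_pos).ne'
  · exact ((min_le_right _ _).trans_lt ENNReal.one_lt_top).ne

lemma ofReal_areaBound_le (ε : ℝ) :
    ENNReal.ofReal (areaBound ε) ≤ volume (Metric.ball UpperHalfPlane.I (ε / 4)) :=
  ENNReal.ofReal_toReal_le.trans (min_le_left _ _)

lemma thinLE_subset_thinLT (Γ : Subgroup SL(2, ℝ)) {ε R : ℝ} (h : ε < R) :
    thinLE Γ ε ⊆ thinLT Γ R := by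
  apply Set.image_mono
  rintro z ⟨γ, h1, h2, h3, h4⟩
  exact ⟨γ, h1, h2, h3, h4.trans_lt h⟩

lemma BSConvergesToPlane.isLittleO_card {Γ : ℕ → Subgroup SL(2, ℝ)} (hΓ : ∀ n, IsLattice (Γ n))
    (hBS : BSConvergesToPlane Γ) :
    (∀ n, Finite (Cusps (Γ n)) ∧ (conePoints (Γ n)).Finite) ∧
      (fun n => ((Nat.card (Cusps (Γ n)) + (conePoints (Γ n)).ncard : ℕ) : ℝ))
        =o[atTop] (fun n => (vol (Γ n) Set.univ).toReal) := by
  have hdisc := fun n => actsDiscretely_of_discrete (hΓ n).discrete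
  have hc : 0 < areaBound (1 / 180) := areaBound_pos (by norm_num)
  have hreg := fun n => exists_isThinRegions (Γ := Γ n) (ε := 1 / 180) (by norm_num) le_rfl
    (hdisc n) (ofReal_areaBound_le _)
  choose Ω hΩ using hreg
  have hfin := fun n => (hΩ n).finite (hdisc n) (hΓ n).finite_vol hc
  refine ⟨fun n => ⟨?_, ?_⟩, ?_⟩
  · have := hfin n
    exact Finite.of_injective _ (Sum.inr_injective (α := conePoints (Γ n)))
  · have := hfin n
    exact Set.finite_coe_iff.mp (Finite.of_injective _ (Sum.inl_injective (β := Cusps (Γ n))))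
  · rw [isLittleO_iff]
    intro δ hδ
    set c := areaBound (1 / 180)
    have hη : 0 < δ * (c / 2) / 2 := by positivity
    -- Convergence is used only for `R = 1 > 1/180`. The ratio compensates the factor 2 from the
    -- overlaps and the area `c / 2` per region.
    have hev := (hBS 1 one_pos).eventually_le_const (u := ENNReal.ofReal (δ * (c / 2) / 2))
      (by simpa using hη)
    filter_upwards [hev] with n hn
    have hVfin : vol (Γ n) Set.univ ≠ ∞ := (hΓ n).finite_vol.ne
    have h1 := (hΩ n).card_le (hdisc n) (hΓ n).finite_vol hc
    have h2 : vol (Γ n) (thinLE (Γ n) (1 / 180)) ≤ vol (Γ n) (thinLT (Γ n) 1) :=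
      vol_mono (thinLE_subset_thinLT _ (by norm_num))
    have h3 : vol (Γ n) (thinLT (Γ n) 1) ≤
        ENNReal.ofReal (δ * (c / 2) / 2) * vol (Γ n) Set.univ := by
      rcases eq_or_ne (vol (Γ n) Set.univ) 0 with h0 | h0
      · have := vol_mono (Γ := Γ n) (Set.subset_univ (thinLT (Γ n) 1))
        rw [h0] at this ⊢
        simpa using this
      · rwa [ENNReal.div_le_iff h0 hVfin] at hn
    have h4 := h1.trans (mul_le_mul_right (h2.trans h3) 2)
    rw [Real.norm_of_nonneg (by positivity), Real.norm_of_nonneg ENNReal.toReal_nonneg]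
    have h5 := ENNReal.toReal_mono (by finiteness) h4
    rw [ENNReal.toReal_mul, ENNReal.toReal_mul, ENNReal.toReal_mul, ENNReal.toReal_natCast,
      ENNReal.toReal_ofReal (by positivity), ENNReal.toReal_ofReal hη.le] at h5
    simp only [ENNReal.toReal_ofNat] at h5
    have hc2 : 0 < c / 2 := by positivity
    refine le_of_mul_le_mul_right ?_ hc2
    linarith

end HypOrbifold

theorem mainTheorem5 :
    (∀ Γ : ℕ → Subgroup SL(2, ℝ), (∀ n, HypOrbifold.IsLattice (Γ n)) →
      HypOrbifold.BSConvergesToPlane Γ →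
        (∀ n, Finite (HypOrbifold.Cusps (Γ n)) ∧ (HypOrbifold.conePoints (Γ n)).Finite) ∧
        (fun n => ((Nat.card (HypOrbifold.Cusps (Γ n)) + (HypOrbifold.conePoints (Γ n)).ncard : ℕ) : ℝ))
          =o[atTop] (fun n => (HypOrbifold.vol (Γ n) Set.univ).toReal)) ∧
    (∃ ε₀ : ℝ, 0 < ε₀ ∧ ∀ ε : ℝ, 0 < ε → ε ≤ ε₀ → ∃ c : ℝ, 0 < c ∧
      ∀ Γ : Subgroup SL(2, ℝ), HypOrbifold.IsLattice Γ →
        ∃ Ω : HypOrbifold.conePoints Γ ⊕ HypOrbifold.Cusps Γ → Set (HypOrbifold.Orbifold Γ),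
          HypOrbifold.IsThinRegions Γ ε c Ω) := by
  refine ⟨fun Γ hΓ hBS => hBS.isLittleO_card hΓ, 1 / 180, by norm_num, fun ε hε0 hε =>
    ⟨HypOrbifold.areaBound ε, HypOrbifold.areaBound_pos hε0, fun Γ hΓ =>
      HypOrbifold.exists_isThinRegions hε0 hε
        (HypOrbifold.actsDiscretely_of_discrete hΓ.discrete) (HypOrbifold.ofReal_areaBound_le ε)⟩⟩
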